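/- **Setting.** A closed hyperbolic $n$-manifold is a compact quotient $M=\Gamma\backslash\mathbb H^n$ of hyperbolic $n$-space by a group $\Gamma$ of isometries acting freely and properly discontinuously. Let $\Pi_0$ be a pair of pants, with $\pi_1(\Pi_0)=\langle\gamma_0,\gamma_1,\gamma_2\mid\gamma_0\gamma_1\gamma_2=1\rangle$, where $\gamma_0,\gamma_1,\gamma_2$ are freely homotopic to the three boundary components. Indices $i$ are taken in $\mathbb Z/3\mathbb Z$. For $A,B\in M$ let $\pi_1(M,A,B)$ be the set of homotopy classes, rel endpoints, of paths from $A$ to $B$; products of paths are written in the order of travel. A *pants* $\Pi$ in $M$ is given by an injective homomorphism $\rho\colon\pi_1(\Pi_0)\to\pi_1(M,P)$, $P\in M$; two such homomorphisms $\rho$ (at $P$) and $\rho'$ (at $P'$) determine the same pants if there is $\alpha\in\pi_1(M,P,P')$ with $\rho'(\gamma_i)=\alpha^{-1}\rho(\gamma_i)\alpha$ for all $i$. The *cuffs* of $\Pi$ are the oriented closed geodesics freely homotopic to the $\rho(\gamma_i)$. The pants $\Pi$ is *$(R,\epsilon)$-cuff-good* if every cuff has length $\ell$ with $2R-2\epsilon<\ell<2R+2\epsilon$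 and its monodromy (parallel transport once around the cuff, acting on the normal space of the cuff at a point) makes an angle at most $\epsilon$ between any unit normal vector and its image. Let $G(\Pi,M)$ be the set of triples $(P,Q,(\eta_i))$ such that $P,Q\in M$, each $\eta_i$ ($i\in\mathbb Z/3\mathbb Z$) is a geodesic segment from $P$ to $Q$ (possibly of length $0$), and the representation $\gamma_{i+1}\mapsto\eta_i\eta_{i+1}^{-1}$ into $\pi_1(M,P)$ determines $\Pi$. The *Steiner graph* of $\Pi$ is the element of $G(\Pi,M)$ of least total length $|\eta_0|+|\eta_1|+|\eta_2|$; it is *degenerate* if some $\eta_i$ has length $0$. A *tripod* is an ordered triple of unit tangent vectors at one point, any two of which make the angle $2\pi/3$. **Proposition.** There exists $R_0>0$ (a universal constant) such that for all $R>R_0$, all $0\le\epsilon<1$, all $n$, and every $(R,\epsilon)$-cuff-good pants $\Pi$ in a closed hyperbolic $n$-manifold $M$, the following holds. The Steiner graph $(P,Q,(\eta_i))$ of $\Pi$ exists, is unique, and is not degenerate. Moreover, at each of the two vertices $P$ and $Q$ the angle between any two of the three edges is $2\pi/3$. Hence the unit directions of $\eta_0,\eta_1,\eta_2$ at $P$,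 and the unit directions at $Q$ of the reversed edges $\eta_0^{-1},\eta_{-1}^{-1},\eta_{-2}^{-1}$, form two tripods, which generate $\Pi$ through the connections $\eta_i$. -/

import Mathlib

noncomputable section

namespace SteinerPants

/-! ### Hyperbolic space: the hyperboloid model -/

/-- Minkowski space `ℝ^{1,n}`, with the time coordinate first. -/
abbrev Mink (n : ℕ) : Type := ℝ × EuclideanSpace ℝ (Fin n)

/-- The Lorentz form, of signature `(1,n)`. -/
def form {n : ℕ} (x y : Mink n) : ℝ := x.1 * y.1 - inner ℝ x.2 y.2

/-- The upper sheet of the hyperboloid `form x x = 1`. -/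
def IsHyp {n : ℕ} (x : Mink n) : Prop := form x x = 1 ∧ 0 < x.1

/-- Hyperbolic `n`-space, with the topology induced from Minkowski space. Its Riemannian metric is
the restriction of `-form` to the tangent spaces `{v | form x v = 0}`. -/
def Hyp (n : ℕ) : Type := {x : Mink n // IsHyp x}

instance (n : ℕ) : TopologicalSpace (Hyp n) :=
  inferInstanceAs (TopologicalSpace {x : Mink n // IsHyp x})

section lemmas

variable {n : ℕ}

theorem form_add_smul (a b c d : ℝ) (x y z w : Mink n) :
    form (a • x + b • y) (c • z + d • w)
      = a * c * form x z + a * d * form x w + b * c * form y z + b * d * form y w := by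
  simp only [form, Prod.fst_add, Prod.snd_add, Prod.smul_fst, Prod.smul_snd, smul_eq_mul,
    inner_add_left, inner_add_right, real_inner_smul_left, real_inner_smul_right]
  ring

theorem form_comm (x y : Mink n) : form x y = form y x := by
  simp only [form, real_inner_comm]
  ring

theorem form_smul_right (a : ℝ) (x y : Mink n) : form x (a • y) = a * form x y := by
  simp only [form, Prod.smul_fst, Prod.smul_snd, smul_eq_mul, real_inner_smul_right]
  ring

/-- Tangent vectors at a point of the hyperboloid are spacelike, with a bound on the time
coordinate. -/
theorem tangent_bound {x v : Mink n} (hx : IsHyp x) (hv : form x v = 0) :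
    v.1 ^ 2 ≤ (x.1 ^ 2 - 1) * (-form v v) := by
  have h1 := real_inner_mul_inner_self_le x.2 v.2
  have hx1 := hx.1
  simp only [form] at hx1 hv ⊢
  have e1 : inner ℝ x.2 v.2 = x.1 * v.1 := by linarith
  have e2 : inner ℝ x.2 x.2 = x.1 * x.1 - 1 := by linarith
  rw [e1, e2] at h1
  nlinarith

theorem one_le_time {x : Mink n} (hx : IsHyp x) : 1 ≤ x.1 := by
  have hx1 := hx.1
  simp only [form] at hx1
  have := real_inner_self_nonneg (x := x.2)
  nlinarith [hx.2]

theorem tangent_nonneg {x v : Mink n} (hx : IsHyp x) (hv : form x v = 0) : 0 ≤ -form v v := by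
  have h1 := real_inner_mul_inner_self_le x.2 v.2
  have hx1 := hx.1
  have h2 := one_le_time hx
  simp only [form] at hx1 hv ⊢
  have e1 : inner ℝ x.2 v.2 = x.1 * v.1 := by linarith
  have e2 : inner ℝ x.2 x.2 = x.1 * x.1 - 1 := by linarith
  rw [e1, e2] at h1
  have h3 := real_inner_self_nonneg (x := v.2)
  by_contra h
  push Not at h
  nlinarith [mul_pos (by linarith : 0 < x.1) (by linarith : 0 < x.1)]

end lemmas

/-! ### Isometries -/

/-- The isometry group `O⁺(n,1)` of hyperbolic space: the linear automorphisms of Minkowski space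
that preserve the form and the upper sheet. -/
def Isom (n : ℕ) : Subgroup (Mink n ≃ₗ[ℝ] Mink n) where
  carrier := {g | (∀ x y, form (g x) (g y) = form x y) ∧ ∀ x, IsHyp (g x) ↔ IsHyp x}
  mul_mem' := by
    rintro a b ⟨ha, ha'⟩ ⟨hb, hb'⟩
    refine ⟨fun x y => ?_, fun x => ?_⟩
    · rw [LinearEquiv.mul_apply, LinearEquiv.mul_apply, ha, hb]
    · rw [LinearEquiv.mul_apply, ha', hb']
  one_mem' := ⟨fun _ _ => rfl, fun _ => Iff.rfl⟩
  inv_mem' := by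
    rintro a ⟨ha, ha'⟩
    have key : ∀ x, a (a⁻¹ x) = x := fun x => a.apply_symm_apply x
    refine ⟨fun x y => ?_, fun x => ?_⟩
    · rw [← ha, key, key]
    · rw [← ha', key]

instance (n : ℕ) : MulAction (Isom n) (Hyp n) where
  smul g x := ⟨g.1 x.1, (g.2.2 x.1).2 x.2⟩
  one_smul _ := rfl
  mul_smul _ _ _ := rfl

/-! ### Tangent vectors and the geodesic flow -/

/-- A tangent vector of hyperbolic space, with its base point. -/
@[ext] structure TangentVector (n : ℕ) where
  base : Hyp n
  vec : Mink n
  orth : form base.1 vec = 0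

namespace TangentVector

variable {n : ℕ}

/-- The Riemannian norm of a tangent vector. -/
def speed (τ : TangentVector n) : ℝ := Real.sqrt (-form τ.vec τ.vec)

theorem form_vec (τ : TangentVector n) : form τ.vec τ.vec = -τ.speed ^ 2 := by
  rw [speed, Real.sq_sqrt (tangent_nonneg τ.base.2 τ.orth), neg_neg]

/-- The Riemannian angle between two nonzero tangent vectors at the same point. -/
def angle (τ σ : TangentVector n) : ℝ :=
  Real.arccos (-form τ.vec σ.vec / (τ.speed * σ.speed))

/-- Multiplication of a tangent vector by a scalar. -/
def scale (a : ℝ) (τ : TangentVector n) : TangentVector n where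
  base := τ.base
  vec := a • τ.vec
  orth := by rw [form_smul_right, τ.orth, mul_zero]

/-- The opposite tangent vector. -/
def reverse (τ : TangentVector n) : TangentVector n := τ.scale (-1)

/-- The unit vector in the direction of a nonzero tangent vector. -/
def unit (τ : TangentVector n) : TangentVector n := τ.scale τ.speed⁻¹

/-- The action of isometries on tangent vectors, by their differentials. -/
def map (g : Isom n) (τ : TangentVector n) : TangentVector n where
  base := g • τ.base
  vec := g.1 τ.vec
  orth := (g.2.1 τ.base.1 τ.vec).trans τ.orth

theorem flow_isHyp (τ : TangentVector n) (t : ℝ) :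
    IsHyp (Real.cosh (t * τ.speed) • τ.base.1
      + (Real.sinh (t * τ.speed) / τ.speed) • τ.vec) := by
  have hs : 0 ≤ τ.speed := Real.sqrt_nonneg _
  have hcs := Real.cosh_sq (t * τ.speed)
  have hc := Real.cosh_pos (t * τ.speed)
  have hx1 := one_le_time τ.base.2
  set c := Real.cosh (t * τ.speed) with hcdef
  set q := Real.sinh (t * τ.speed) / τ.speed with hq
  have hqs : q * τ.speed = Real.sinh (t * τ.speed) := by
    rcases eq_or_ne τ.speed 0 with h | h
    · simp [h]
    · rw [hq, div_mul_cancel₀ _ h]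
  have hcq : c ^ 2 = (q * τ.speed) ^ 2 + 1 := by rw [hqs, hcs]
  refine ⟨?_, ?_⟩
  · rw [form_add_smul, τ.base.2.1, form_comm τ.vec, τ.orth, form_vec]
    nlinarith
  · have hb := tangent_bound τ.base.2 τ.orth
    rw [form_vec, neg_neg] at hb
    change 0 < c * τ.base.1.1 + q * τ.vec.1
    have h1 : (q * τ.vec.1) ^ 2 < (c * τ.base.1.1) ^ 2 := by
      have h2 : (q * τ.vec.1) ^ 2 ≤ (τ.base.1.1 ^ 2 - 1) * (q * τ.speed) ^ 2 := by
        calc (q * τ.vec.1) ^ 2 = q ^ 2 * τ.vec.1 ^ 2 := by ring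
          _ ≤ q ^ 2 * ((τ.base.1.1 ^ 2 - 1) * τ.speed ^ 2) :=
            mul_le_mul_of_nonneg_left hb (sq_nonneg q)
          _ = _ := by ring
      have h3 : (c * τ.base.1.1) ^ 2 = ((q * τ.speed) ^ 2 + 1) * τ.base.1.1 ^ 2 := by
        rw [← hcq]; ring
      nlinarith [sq_nonneg (q * τ.speed)]
    have := abs_lt_of_sq_lt_sq h1 (by positivity)
    linarith [(abs_lt.1 this).1]

/-- The geodesic flow: `τ.flow t` is the velocity at time `t` of the geodesic with initial
velocity `τ`. -/
def flow (τ : TangentVector n) (t : ℝ) : TangentVector n where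
  base := ⟨Real.cosh (t * τ.speed) • τ.base.1 + (Real.sinh (t * τ.speed) / τ.speed) • τ.vec,
    τ.flow_isHyp t⟩
  vec := (τ.speed * Real.sinh (t * τ.speed)) • τ.base.1 + Real.cosh (t * τ.speed) • τ.vec
  orth := by
    rw [form_add_smul, τ.base.2.1, form_comm τ.vec, τ.orth, form_vec]
    rcases eq_or_ne τ.speed 0 with h | h
    · simp [h]
    · field_simp
      ring

end TangentVector

/-! ### Closed hyperbolic manifolds -/

/-- The quotient space `Γ \ ℍⁿ`, with the quotient topology. -/
abbrev Mfd {n : ℕ} (Γ : Subgroup (Isom n)) : Type := MulAction.orbitRel.Quotient Γ (Hyp n)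

/-- The projection `ℍⁿ → Γ \ ℍⁿ`. -/
def proj {n : ℕ} (Γ : Subgroup (Isom n)) (x : Hyp n) : Mfd Γ := Quotient.mk _ x

/-- `Γ \ ℍⁿ` is a closed hyperbolic manifold: `Γ` acts freely, properly discontinuously and
cocompactly on `ℍⁿ`. -/
structure IsClosedHyperbolic {n : ℕ} (Γ : Subgroup (Isom n)) : Prop where
  properlyDiscontinuous : ProperlyDiscontinuousSMul Γ (Hyp n)
  free : ∀ g ∈ Γ, ∀ x : Hyp n, g • x = x → g = 1
  compact : CompactSpace (Mfd Γ)

/-- `π₁(M, A, B)`: homotopy classes, relative to the endpoints, of paths from `A` to `B`. -/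
abbrev PathClass {X : Type} [TopologicalSpace X] (A B : X) : Type := Path.Homotopic.Quotient A B

section manifold

variable {n : ℕ} {Γ : Subgroup (Isom n)}

/-- The path `c` in `Γ \ ℍⁿ` is the projection of the geodesic with initial velocity `τ`, run
through the time interval `[0,1]`. Its initial velocity is then the class of `τ` in the tangent
bundle `Γ \ Tℍⁿ`, and its length is `τ.speed`. -/
def IsGeodesicLift {P Q : Mfd Γ} (c : Path P Q) (τ : TangentVector n) : Prop :=
  ∀ t : unitInterval, c t = proj Γ (τ.flow t).base

/-- A geodesic segment in `Γ \ ℍⁿ` (of constant speed, possibly of length zero), with its length. -/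
structure GeodesicSegment (P Q : Mfd Γ) where
  path : Path P Q
  length : ℝ
  isGeodesic : ∃ τ : TangentVector n, IsGeodesicLift path τ ∧ τ.speed = length

/-- `c` is a closed geodesic in `Γ \ ℍⁿ`, covered by the geodesic with initial velocity `τ`; the
deck transformation `h` takes the initial velocity to the velocity after one period. -/
structure IsClosedGeodesic {A : Mfd Γ} (c : Path A A) (τ : TangentVector n) (h : Isom n) :
    Prop where
  lift : IsGeodesicLift c τ
  speed_pos : 0 < τ.speed
  mem : h ∈ Γ
  closes : τ.flow 1 = τ.map h

/-- The monodromy of the closed geodesic covered by `τ`, with deck transformation `h`, is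
`ε`-close to the identity: no unit normal vector makes an angle greater than `ε` with its image.

A vector `w` normal to the geodesic of `τ` at its start is orthogonal to the plane of this geodesic
in Minkowski space, so its parallel transport along the geodesic is constant, equal to `w`; the
identification of the tangent spaces at the two endpoints of a period is by `h⁻¹`. -/
def MonodromyClose (τ : TangentVector n) (h : Isom n) (ε : ℝ) : Prop :=
  ∀ w : Mink n, form τ.base.1 w = 0 → form τ.vec w = 0 → form w w = -1 →
    Real.arccos (-form w ((h⁻¹).1 w)) ≤ ε

/-! ### Pants -/

/-- The fundamental group of a pair of pants: the generators `γ₀, γ₁, γ₂` are freely homotopic to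
the three boundary components, and `γ₀ γ₁ γ₂ = 1`. -/
abbrev PantsGroup : Type :=
  PresentedGroup
    ({FreeGroup.of 0 * FreeGroup.of 1 * FreeGroup.of 2} : Set (FreeGroup (ZMod 3)))

variable (Γ) in
/-- A pants in `M = Γ \ ℍⁿ`, given by an injective representation of the pants group in
`π₁(M, base)`. The product of loops is concatenation in the order of travel, which is the opposite
of the multiplication of `FundamentalGroup`. -/
structure Pants where
  base : Mfd Γ
  rep : PantsGroup →* (FundamentalGroup (Mfd Γ) base)ᵐᵒᵖ
  injective : Function.Injective rep

/-- The homotopy class of the loop which is the image of the generator `γᵢ`. -/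
def Pants.loop (S : Pants Γ) (i : ZMod 3) : PathClass S.base S.base :=
  FundamentalGroup.toPath (S.rep (PresentedGroup.of i)).unop

/-- `η⁻¹ a η`, for a class of loops `a` at `A` and a class of paths `η` from `A` to `B`. -/
def conjClass {X : Type} [TopologicalSpace X] {A B : X} (η : PathClass A B) (a : PathClass A A) :
    PathClass B B :=
  (η.symm.trans a).trans η

/-- The cuff `i` is `(R,ε)`-good: the closed geodesic freely homotopic to the `i`-th boundary
component has length `2ε`-close to `2R` and monodromy `ε`-close to the identity. -/
def Pants.CuffIsGood (S : Pants Γ) (R ε : ℝ) (i : ZMod 3) : Prop :=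
  ∃ (A : Mfd Γ) (c : Path A A) (τ : TangentVector n) (h : Isom n),
    IsClosedGeodesic c τ h ∧
    (∃ η : PathClass S.base A, Path.Homotopic.Quotient.mk c = conjClass η (S.loop i)) ∧
    2 * R - 2 * ε < τ.speed ∧ τ.speed < 2 * R + 2 * ε ∧
    MonodromyClose τ h ε

/-- A pants is `(R,ε)`-cuff-good if all its cuffs are `(R,ε)`-good. -/
def Pants.IsCuffGood (S : Pants Γ) (R ε : ℝ) : Prop := ∀ i, S.CuffIsGood R ε i

/-! ### The Steiner graph -/

variable (Γ) in
/-- A triple `(P, Q, (ηᵢ))`, where each `ηᵢ` is a geodesic segment from `P` to `Q`. -/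
structure ThetaGraph where
  P : Mfd Γ
  Q : Mfd Γ
  edge : ZMod 3 → GeodesicSegment P Q

namespace ThetaGraph

/-- The homotopy class of the edge `ηᵢ`. -/
def edgeClass (G : ThetaGraph Γ) (i : ZMod 3) : PathClass G.P G.Q :=
  Path.Homotopic.Quotient.mk (G.edge i).path

/-- The total length `|η₀| + |η₁| + |η₂|`. -/
def length (G : ThetaGraph Γ) : ℝ := ∑ i : ZMod 3, (G.edge i).length

/-- Some edge has length zero. -/
def IsDegenerate (G : ThetaGraph Γ) : Prop := ∃ i, (G.edge i).length = 0

/-- `G` belongs to the space `G(Π, M)` of the pants `Π = S`: the representation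
`γᵢ₊₁ ↦ ηᵢ ηᵢ₊₁⁻¹` determines the same pants as `S`. -/
def Generates (G : ThetaGraph Γ) (S : Pants Γ) : Prop :=
  ∃ α : PathClass S.base G.P, ∀ i : ZMod 3,
    (G.edgeClass i).trans (G.edgeClass (i + 1)).symm = conjClass α (S.loop (i + 1))

/-- `G` has minimal length in `G(Π, M)`. -/
def IsSteinerGraph (G : ThetaGraph Γ) (S : Pants Γ) : Prop :=
  G.Generates S ∧ ∀ G' : ThetaGraph Γ, G'.Generates S → G.length ≤ G'.length

/-- The `τ i` are the velocities at `P` of the edges of `G`, lifted to a common lift of `P`. -/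
def DirectionsAtP (G : ThetaGraph Γ) (τ : ZMod 3 → TangentVector n) : Prop :=
  (∀ i j, (τ i).base = (τ j).base) ∧ ∀ i, IsGeodesicLift (G.edge i).path (τ i)

/-- The `σ i` are the velocities at `Q` of the reversed edges of `G`, lifted to a common lift
of `Q`. -/
def DirectionsAtQ (G : ThetaGraph Γ) (σ : ZMod 3 → TangentVector n) : Prop :=
  (∀ i j, (σ i).base = (σ j).base) ∧
    ∀ i, ∃ τ, IsGeodesicLift (G.edge i).path τ ∧ σ i = (τ.flow 1).reverse

end ThetaGraph

end manifold

/-- An ordered triple of unit tangent vectors at the same point, any two of which enclose the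
angle `2π/3`. -/
def IsTripod {n : ℕ} (τ : ZMod 3 → TangentVector n) : Prop :=
  (∀ i j, (τ i).base = (τ j).base) ∧ (∀ i, (τ i).speed = 1) ∧
    ∀ i j, i ≠ j → (τ i).angle (τ j) = 2 * Real.pi / 3

end SteinerPants

end

/-!
## Why the Steiner graph exists, is unique, and has angles `2π/3`

Fix a lift of the base point of the pants. The loops `γᵢ` become deck transformations, and they can
be written as `γᵢ₊₁ = aᵢ aᵢ₊₁⁻¹` for a sequence `a` in `Γ` (`exists_isHolonomy`). A theta graph
generates the pants exactly when its edges lift to the geodesics from a point `p` to the points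
`aᵢ q`, for some pair `(p, q)` (`IsHolonomy.exists_development`, `IsHolonomy.exists_generates`).
So the problem is to minimize `thetaLength a p q = ∑ d(p, aᵢ q)` over `ℍⁿ × ℍⁿ`. The roles of `p`
and `q` are symmetric, on replacing `aᵢ` by `aᵢ⁻¹`.

* Existence (`IsClosedHyperbolic.exists_isMinimal`). By cocompactness both points can be moved to a
  fixed compact set, at the expense of changing `a`; by proper discontinuity only finitely many
  sequences arise from pairs of bounded length.
* Nondegeneracy (`IsMinimal.ne_smul`). Suppose that `p = aᵢ q` at a minimum. The first variation
  with respect to `p` and to `q` shows that the other two edges leave this point, and arrive at it,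
  at an angle at least `2π/3` from each other. They are at least as long as two of the cuffs, and
  the third cuff is freely homotopic to their union. Its lift is a broken geodesic with long edges
  and angles at least `2π/3`, along which the hyperbolic cosine of the distance to the start grows
  by a definite factor at each edge (`form_growth`). Hence the third cuff has length at least
  `4R - 6`, while cuff-goodness gives at most `2R + 2`.
* Angles. At a nondegenerate minimum the three unit directions at each vertex add up to zero
  (`sum_dir_eq_zero`), hence form a tripod.
* Uniqueness (`IsMinimal.unique`). The distance is midpoint convex (`hdist_mid_mid_le`), so between
  two minima all inequalities are equalities. If `p ≠ p'`, this puts all the `aᵢ q` on the geodesic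
  through `p` and `p'`, and three unit vectors tangent to one line do not add up to zero
  (`eq_of_collinear`).
-/

noncomputable section

namespace SteinerPants

/-! ### Lorentz geometry of the hyperboloid -/

section Lorentz

variable {n : ℕ}

theorem form_add_left (x y z : Mink n) : form (x + y) z = form x z + form y z := by
  simp only [form, Prod.fst_add, Prod.snd_add, inner_add_left]; ring

theorem form_smul_left (a : ℝ) (x y : Mink n) : form (a • x) y = a * form x y := by
  rw [form_comm, form_smul_right, form_comm]

theorem form_add_right (x y z : Mink n) : form x (y + z) = form x y + form x z := by
  rw [form_comm, form_add_left, form_comm y, form_comm z]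

theorem form_neg_left (x y : Mink n) : form (-x) y = -form x y := by
  rw [← neg_one_smul ℝ x, form_smul_left]; ring

theorem form_sub_left (x y z : Mink n) : form (x - y) z = form x z - form y z := by
  rw [sub_eq_add_neg, form_add_left, form_neg_left]; ring

theorem form_sub_right (x y z : Mink n) : form x (y - z) = form x y - form x z := by
  rw [form_comm, form_sub_left, form_comm y, form_comm z]

theorem form_zero_left (x : Mink n) : form 0 x = 0 := by simp [form]

theorem form_zero_right (x : Mink n) : form x 0 = 0 := by simp [form]

theorem form_sum_right {ι : Type*} (s : Finset ι) (x : Mink n) (f : ι → Mink n) :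
    form x (∑ i ∈ s, f i) = ∑ i ∈ s, form x (f i) := by
  classical
  induction s using Finset.induction_on with
  | empty => simp [form_zero_right]
  | insert a s ha ih => rw [Finset.sum_insert ha, Finset.sum_insert ha, form_add_right, ih]

theorem continuous_form : Continuous fun z : Mink n × Mink n => form z.1 z.2 := by
  unfold form; fun_prop

theorem form_self (p : Hyp n) : form p.1 p.1 = 1 := p.2.1

theorem form_map (g : Isom n) (x y : Mink n) : form (g.1 x) (g.1 y) = form x y := g.2.1 x y

theorem form_smul_smul (g : Isom n) (p q : Hyp n) : form (g • p).1 (g • q).1 = form p.1 q.1 :=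
  g.2.1 p.1 q.1

theorem form_smul_inv (g : Isom n) (p q : Hyp n) :
    form (g • p).1 q.1 = form p.1 (g⁻¹ • q).1 := by
  rw [← form_smul_smul g⁻¹, inv_smul_smul]

/-- A tangent vector of zero norm vanishes: the tangent spaces are spacelike. -/
theorem eq_zero_of_tangent {p : Hyp n} {v : Mink n} (hv : form p.1 v = 0) (h : form v v = 0) :
    v = 0 := by
  have h1 := tangent_bound p.2 hv
  rw [h, neg_zero, mul_zero] at h1
  have h2 : v.1 = 0 := by nlinarith
  refine Prod.ext h2 ?_
  simpa [form, h2] using h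

/-- The Cauchy-Schwarz inequality on a tangent space. -/
theorem tangent_cauchy_schwarz {p : Hyp n} {v w : Mink n} (hv : form p.1 v = 0)
    (hw : form p.1 w = 0) : form v w ^ 2 ≤ form v v * form w w := by
  have key : ∀ t : ℝ, 0 ≤ (-form v v) * (t * t) + (-(2 * form v w)) * t + (-form w w) := by
    intro t
    have := tangent_nonneg (v := t • v + w) p.2
      (by rw [form_add_right, form_smul_right, hv, hw]; ring)
    simp only [form_add_left, form_add_right, form_smul_left, form_smul_right,
      form_comm w v] at this
    linarith
  have := discrim_le_zero key
  unfold discrim at this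
  nlinarith

/-- The component `q - form p q • p` of `q` is tangent at `p`. -/
theorem form_tangent_part (p q : Hyp n) : form p.1 (q.1 - form p.1 q.1 • p.1) = 0 := by
  rw [form_sub_right, form_smul_right, form_self]; ring

theorem form_tangent_part_self (p q : Hyp n) :
    form (q.1 - form p.1 q.1 • p.1) (q.1 - form p.1 q.1 • p.1) = 1 - form p.1 q.1 ^ 2 := by
  simp only [form_sub_right, form_smul_right, form_self, form_sub_left, form_smul_left,
    form_comm q.1 p.1]
  ring

theorem form_pos (p q : Hyp n) : 0 < form p.1 q.1 := by
  have hp := p.2.1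
  have hq := q.2.1
  have hp0 := p.2.2
  have hq0 := q.2.2
  have h := real_inner_le_norm p.1.2 q.1.2
  simp only [form, real_inner_self_eq_norm_sq] at hp hq ⊢
  have h1 : ‖p.1.2‖ < p.1.1 := by
    apply lt_of_pow_lt_pow_left₀ 2 hp0.le; nlinarith
  have h2 : ‖q.1.2‖ < q.1.1 := by
    apply lt_of_pow_lt_pow_left₀ 2 hq0.le; nlinarith
  nlinarith [norm_nonneg p.1.2, norm_nonneg q.1.2]

theorem one_le_form (p q : Hyp n) : 1 ≤ form p.1 q.1 := by
  have h := tangent_nonneg p.2 (form_tangent_part p q)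
  rw [form_tangent_part_self] at h
  nlinarith [form_pos p q]

theorem eq_of_form_eq_one {p q : Hyp n} (h : form p.1 q.1 = 1) : p = q := by
  have h1 := eq_zero_of_tangent (form_tangent_part p q)
    (by rw [form_tangent_part_self, h]; ring)
  rw [h, one_smul, sub_eq_zero] at h1
  exact Subtype.ext h1.symm

theorem one_lt_form {p q : Hyp n} (h : p ≠ q) : 1 < form p.1 q.1 :=
  lt_of_le_of_ne (one_le_form p q) fun h' => h (eq_of_form_eq_one h'.symm)

/-- The hyperbolic distance. -/
def hdist (p q : Hyp n) : ℝ := Real.arcosh (form p.1 q.1)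

theorem cosh_hdist (p q : Hyp n) : Real.cosh (hdist p q) = form p.1 q.1 :=
  Real.cosh_arcosh (one_le_form p q)

theorem sinh_hdist (p q : Hyp n) : Real.sinh (hdist p q) = √(form p.1 q.1 ^ 2 - 1) :=
  Real.sinh_arcosh (one_le_form p q)

theorem hdist_nonneg (p q : Hyp n) : 0 ≤ hdist p q := Real.arcosh_nonneg (one_le_form p q)

theorem hdist_comm (p q : Hyp n) : hdist p q = hdist q p := by rw [hdist, form_comm, hdist]

theorem hdist_eq_zero_iff {p q : Hyp n} : hdist p q = 0 ↔ p = q := by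
  rw [hdist, Real.arcosh_eq_zero_iff (one_le_form p q)]
  exact ⟨eq_of_form_eq_one, fun h => h ▸ form_self p⟩

theorem hdist_pos {p q : Hyp n} (h : p ≠ q) : 0 < hdist p q :=
  Real.arcosh_pos (one_lt_form h)

theorem hdist_smul_smul (g : Isom n) (p q : Hyp n) : hdist (g • p) (g • q) = hdist p q := by
  rw [hdist, form_smul_smul, hdist]

theorem hdist_smul_right (g : Isom n) (p q : Hyp n) : hdist p (g • q) = hdist (g⁻¹ • p) q := by
  rw [← hdist_smul_smul g⁻¹, inv_smul_smul]

theorem continuous_hdist : Continuous fun z : Hyp n × Hyp n => hdist z.1 z.2 := by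
  have h : Continuous fun z : Hyp n × Hyp n => form z.1.1 z.2.1 :=
    continuous_form.comp ((continuous_subtype_val.comp continuous_fst).prodMk
      (continuous_subtype_val.comp continuous_snd))
  exact Real.continuousOn_arcosh.comp_continuous h fun z => one_le_form z.1 z.2

/-- The Gram determinant of three points of the hyperboloid is nonnegative. -/
theorem gram_nonneg (x y z : Hyp n) :
    (form x.1 y.1 * form y.1 z.1 - form x.1 z.1) ^ 2
      ≤ (form x.1 y.1 ^ 2 - 1) * (form y.1 z.1 ^ 2 - 1) := by
  have h := tangent_cauchy_schwarz (form_tangent_part y x) (form_tangent_part y z)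
  rw [form_tangent_part_self, form_tangent_part_self] at h
  simp only [form_sub_right, form_smul_right, form_self, form_sub_left, form_smul_left] at h
  rw [form_comm y.1 x.1] at h
  nlinarith

theorem hdist_triangle (x y z : Hyp n) : hdist x z ≤ hdist x y + hdist y z := by
  have h := gram_nonneg x y z
  have h1 := hdist_nonneg x y
  have h2 := hdist_nonneg y z
  have h3 := one_le_form x y
  have h4 := one_le_form y z
  rw [← abs_of_nonneg (hdist_nonneg x z), ← abs_of_nonneg (add_nonneg h1 h2),
    ← Real.cosh_le_cosh, Real.cosh_add, cosh_hdist, cosh_hdist, cosh_hdist, sinh_hdist,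
    sinh_hdist, ← Real.sqrt_mul (by nlinarith)]
  have := Real.abs_le_sqrt h
  linarith [neg_abs_le (form x.1 y.1 * form y.1 z.1 - form x.1 z.1)]

/-- The initial unit vector of the geodesic from `p` to `q` (zero when `p = q`). -/
def dir (p q : Hyp n) : Mink n :=
  (√(form p.1 q.1 ^ 2 - 1))⁻¹ • (q.1 - form p.1 q.1 • p.1)

theorem form_dir (p q : Hyp n) : form p.1 (dir p q) = 0 := by
  rw [dir, form_smul_right, form_tangent_part, mul_zero]

theorem dir_self (p : Hyp n) : dir p p = 0 := by
  simp [dir, form_self]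

theorem form_dir_self {p q : Hyp n} (h : p ≠ q) : form (dir p q) (dir p q) = -1 := by
  have h1 := one_lt_form h
  have h2 : 0 < form p.1 q.1 ^ 2 - 1 := by nlinarith
  rw [dir, form_smul_right, form_smul_left, form_tangent_part_self]
  have h3 := Real.sq_sqrt h2.le
  have h4 := (Real.sqrt_pos.2 h2).ne'
  field_simp
  rw [h3]; ring

theorem eq_cosh_add_sinh (p q : Hyp n) :
    q.1 = Real.cosh (hdist p q) • p.1 + Real.sinh (hdist p q) • dir p q := by
  by_cases h : p = q
  · subst h
    rw [dir_self, hdist_eq_zero_iff.2 rfl]; simp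
  · have h1 := one_lt_form h
    have h2 : 0 < form p.1 q.1 ^ 2 - 1 := by nlinarith
    rw [cosh_hdist, sinh_hdist, dir, smul_inv_smul₀ (Real.sqrt_pos.2 h2).ne']
    abel

theorem dir_smul (g : Isom n) (p q : Hyp n) : dir (g • p) (g • q) = g.1 (dir p q) := by
  rw [dir, dir, form_smul_smul, map_smul, map_sub, map_smul]
  rfl

end Lorentz

/-! ### Long broken geodesics -/

section BrokenGeodesic

variable {n : ℕ}

/-- If `y` is much farther from `b` than from `a`, then `y` lies almost in the direction of `a`
as seen from `b`, hence in a direction opposite to `c` when the angle between `a` and `c` is at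
least `2π/3`. -/
theorem form_growth {y a b c : Hyp n} (hab : 8 ≤ form a.1 b.1) (hbc : b ≠ c)
    (hang : 1 / 2 ≤ form (dir b a) (dir b c)) (hy : 8 * form y.1 a.1 ≤ form y.1 b.1) :
    form b.1 c.1 * form y.1 b.1 ≤ form y.1 c.1 := by
  have hX := form_pos y b
  have hba : b ≠ a := fun h => by
    rw [h, form_self] at hab; norm_num at hab
  set X := form y.1 b.1 with hXdef
  set u := dir b a with hu
  set w := dir b c with hw
  have hu0 : form b.1 u = 0 := form_dir b a
  have hw0 : form b.1 w = 0 := form_dir b c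
  have huu : form u u = -1 := form_dir_self hba
  have hww : form w w = -1 := form_dir_self hbc
  have hd := form_comm b.1 a.1 ▸ hab
  have ea := congrArg (form y.1) (eq_cosh_add_sinh b a)
  have ec := congrArg (form y.1) (eq_cosh_add_sinh b c)
  rw [form_add_right, form_smul_right, form_smul_right, cosh_hdist] at ea ec
  have hs : Real.sinh (hdist b a) ^ 2 = form b.1 a.1 ^ 2 - 1 := by
    rw [Real.sinh_sq, cosh_hdist]
  have hs0 : 0 ≤ Real.sinh (hdist b a) := Real.sinh_nonneg_iff.2 (hdist_nonneg b a)
  have hs2 : 0 ≤ Real.sinh (hdist b c) := Real.sinh_nonneg_iff.2 (hdist_nonneg b c)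
  rw [← hu, ← hXdef] at ea
  rw [← hw, ← hXdef] at ec
  set s := Real.sinh (hdist b a)
  -- `z` is the tangential part of `y` at `b`, scaled so that `-form z z ≤ 1`.
  set z : Mink n := X⁻¹ • (y.1 - X • b.1) with hz
  have hyb : form b.1 y.1 = X := form_comm _ _
  have hz0 : form b.1 z = 0 := by
    rw [hz, form_smul_right, form_sub_right, form_smul_right, form_self, hyb]; ring
  have hzz : form z z = X⁻¹ ^ 2 - 1 := by
    rw [hz]
    simp only [form_smul_right, form_smul_left, form_sub_left, form_sub_right, form_self, hyb,
      ← hXdef]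
    field_simp
    ring
  have hzv : ∀ v : Mink n, form b.1 v = 0 → form y.1 v = X * form z v := by
    intro v hv
    rw [hz, form_smul_left, form_sub_left, form_smul_left, hv]
    field_simp
    ring
  have hyu := hzv u hu0
  have hyw := hzv w hw0
  -- `z` is close to `u`: the factor `8` gives `-form (z - u) (z - u) ≤ 2 / 8`, so `form · w` differs
  -- at `z` and at `u` by at most `1 / 2`, which is the lower bound `hang` at `u`.
  have hzu : form z u ≤ -(7 / 8) := by
    have h1 : 8 * (form b.1 a.1 + s * form z u) ≤ 1 := by
      have h2 : X * (8 * (form b.1 a.1 + s * form z u)) ≤ X * 1 := by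
        rw [hyu] at ea; nlinarith
      exact le_of_mul_le_mul_left h2 hX
    have h3 : s ≤ form b.1 a.1 := by nlinarith
    have h4 : 1 ≤ s := by nlinarith
    by_contra h
    push Not at h
    nlinarith
  have hdiff : -form (z - u) (z - u) ≤ 1 / 4 := by
    have : 0 ≤ X⁻¹ ^ 2 := sq_nonneg _
    simp only [form_sub_left, form_sub_right, hzz, huu, form_comm u z]
    linarith
  have hcs := tangent_cauchy_schwarz (p := b) (v := z - u) (w := w)
    (by rw [form_sub_right, hz0, hu0]; ring) hw0
  rw [hww] at hcs
  have h5 : form (z - u) w ^ 2 ≤ (1 / 2) ^ 2 := by linarith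
  have h6 := (abs_le_of_sq_le_sq' h5 (by norm_num)).1
  rw [form_sub_left] at h6
  have h7 : 0 ≤ form z w := by linarith
  rw [ec, hyw]
  nlinarith [mul_nonneg hs2 (mul_nonneg hX.le h7)]

/-- A broken geodesic with long edges and angles at least `2π/3` goes off to infinity at the rate
of its length. -/
theorem pow_le_form_of_angles {x : ℕ → Hyp n} {C : ℝ} (hC : 8 ≤ C)
    (hlen : ∀ k, C ≤ form (x k).1 (x (k + 1)).1)
    (hang : ∀ k, 1 / 2 ≤ form (dir (x (k + 1)) (x k)) (dir (x (k + 1)) (x (k + 2)))) (k : ℕ) :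
    C ^ k ≤ form (x 0).1 (x k).1 := by
  have step : ∀ k, C * form (x 0).1 (x k).1 ≤ form (x 0).1 (x (k + 1)).1 := by
    intro k
    induction k with
    | zero => rw [form_self, mul_one]; exact hlen 0
    | succ k ih =>
      have h1 := hlen (k + 1)
      have h0 := form_pos (x 0) (x k)
      have h2 := form_growth (y := x 0) (hC.trans (hlen k))
        (fun h => by
          rw [← h, form_self] at h1; linarith) (hang k) (by nlinarith)
      have h3 := form_pos (x 0) (x (k + 1))
      nlinarith
  induction k with
  | zero => rw [form_self, pow_zero]
  | succ k ih =>
    refine le_trans ?_ (step k)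
    rw [pow_succ']
    exact mul_le_mul_of_nonneg_left ih (by linarith)

end BrokenGeodesic

/-! ### First variation of the sum of distances -/

section FirstVariation

variable {n : ℕ}

open Classical in
/-- The right derivative of the distance to `q` along a unit speed geodesic. It is `1` when the
geodesic starts at `q`, where `dir` vanishes. -/
theorem hasDerivWithinAt_hdist_flow (τ : TangentVector n) (hτ : τ.speed = 1) (q : Hyp n) :
    HasDerivWithinAt (fun t : ℝ => hdist (τ.flow t).base q)
      ((if τ.base = q then 1 else 0) + form τ.vec (dir τ.base q)) (Set.Ioi 0) 0 := by
  have hf : (fun t : ℝ => hdist (τ.flow t).base q) = fun t => Real.arcosh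
      (Real.cosh t * form τ.base.1 q.1 + Real.sinh t * form τ.vec q.1) := by
    funext t
    simp only [hdist, TangentVector.flow, hτ, form_add_left, form_smul_left, mul_one, div_one]
  rw [hf]
  split_ifs with h
  · rw [← h, dir_self, form_zero_right, form_self, form_comm, τ.orth]
    refine ((hasDerivAt_id (0 : ℝ)).hasDerivWithinAt.congr_deriv (by ring)).congr
      (fun t ht => ?_) (by simp)
    simp only [mul_one, mul_zero, add_zero, id]
    exact Real.arcosh_cosh (le_of_lt ht)
  · have h1 := one_lt_form h
    have h2 : HasDerivAt (fun t => Real.cosh t * form τ.base.1 q.1 + Real.sinh t * form τ.vec q.1)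
        (form τ.vec q.1) 0 := by
      have := ((Real.hasDerivAt_cosh 0).mul_const (form τ.base.1 q.1)).add
        ((Real.hasDerivAt_sinh 0).mul_const (form τ.vec q.1))
      simpa using! this
    have h3 := (Real.hasDerivAt_arcosh (x := Real.cosh 0 * form τ.base.1 q.1
      + Real.sinh 0 * form τ.vec q.1) (by simpa using h1)).comp 0 h2
    refine (h3.congr_deriv ?_).hasDerivWithinAt
    simp [dir, form_smul_right, form_sub_right, form_comm τ.vec τ.base.1, τ.orth]

open Classical in
theorem first_variation {p : Hyp n} {q : ZMod 3 → Hyp n}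
    (hmin : ∀ x, ∑ i, hdist p (q i) ≤ ∑ i, hdist x (q i)) {v : Mink n} (hv : form p.1 v = 0)
    (hvv : form v v = -1) :
    0 ≤ ∑ i, ((if p = q i then (1 : ℝ) else 0) + form v (dir p (q i))) := by
  let τ : TangentVector n := ⟨p, v, hv⟩
  have hτ : τ.speed = 1 := by simp [TangentVector.speed, τ, hvv]
  have h0 : (τ.flow 0).base = p := by
    apply Subtype.ext; simp [TangentVector.flow, τ]
  have hd := HasDerivWithinAt.fun_sum (u := Finset.univ)
    fun i _ => hasDerivWithinAt_hdist_flow τ hτ (q i)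
  rw [hasDerivWithinAt_iff_tendsto_slope' (by simp)] at hd
  refine ge_of_tendsto hd (eventually_nhdsWithin_of_forall fun t ht => ?_)
  rw [slope_def_field, h0]
  exact div_nonneg (sub_nonneg.2 (hmin _)) (by simpa using le_of_lt ht)

/-- At a minimum of the sum of the distances to three other points, the unit directions to these
points add up to zero. -/
theorem sum_dir_eq_zero {p : Hyp n} {q : ZMod 3 → Hyp n}
    (hmin : ∀ x, ∑ i, hdist p (q i) ≤ ∑ i, hdist x (q i)) (hne : ∀ i, p ≠ q i) :
    ∑ i, dir p (q i) = 0 := by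
  set U := ∑ i, dir p (q i) with hU
  have hU0 : form p.1 U = 0 := by
    rw [hU, form_sum_right]; exact Finset.sum_eq_zero fun i _ => form_dir p (q i)
  apply eq_zero_of_tangent hU0
  by_contra h
  have h1 : 0 < -form U U := lt_of_le_of_ne (tangent_nonneg p.2 hU0) (by
    intro h'; apply h; linarith)
  have h2 := Real.sq_sqrt h1.le
  have h3 := Real.sqrt_pos.2 h1
  set s := √(-form U U)
  have h4 := first_variation hmin (v := s⁻¹ • U) (by rw [form_smul_right, hU0, mul_zero])
    (by
      rw [form_smul_right, form_smul_left, ← neg_neg (form U U), ← h2]; field_simp)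
  simp only [hne, if_false, zero_add] at h4
  rw [← form_sum_right, ← hU, form_smul_left] at h4
  have : 0 < s⁻¹ := inv_pos.2 h3
  nlinarith

theorem sum_zmod_three (f : ZMod 3 → ℝ) (i : ZMod 3) :
    ∑ j, f j = f i + f (i + 1) + f (i + 2) := by
  have h : ∑ j, f j = f 0 + f 1 + f 2 := Fin.sum_univ_three f
  have h12 : (1 + 1 : ZMod 3) = 2 := by decide
  have h13 : (1 + 2 : ZMod 3) = 0 := by decide
  have h21 : (2 + 1 : ZMod 3) = 0 := by decide
  have h22 : (2 + 2 : ZMod 3) = 1 := by decide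
  rw [h]
  obtain rfl | rfl | rfl : i = 0 ∨ i = 1 ∨ i = 2 := by revert i; decide
  · rw [zero_add, zero_add]
  · rw [h12, h13]; ring
  · rw [h21, h22]; ring

/-- If the sum of the distances to `p` and to two other points is minimal at `p`, then these two
points are seen from `p` under an angle at least `2π/3`. -/
theorem half_le_form_dir {p : Hyp n} {q : ZMod 3 → Hyp n} {i : ZMod 3}
    (hmin : ∀ x, ∑ i, hdist p (q i) ≤ ∑ i, hdist x (q i)) (hi : q i = p)
    (h1 : p ≠ q (i + 1)) (h2 : p ≠ q (i + 2)) :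
    1 / 2 ≤ form (dir p (q (i + 1))) (dir p (q (i + 2))) := by
  have e1 := form_dir_self h1
  have e2 := form_dir_self h2
  set u := dir p (q (i + 1)) with hu
  set w := dir p (q (i + 2)) with hw
  have hU0 : form p.1 (u + w) = 0 := by
    rw [form_add_right, hu, hw, form_dir, form_dir, add_zero]
  have e3 : form (u + w) (u + w) = 2 * form u w - 2 := by
    simp only [form_add_left, form_add_right, e1, e2, form_comm w u]; ring
  by_contra h
  have hp : 1 < -form (u + w) (u + w) := by rw [e3]; linarith
  have s2 := Real.sq_sqrt (zero_le_one.trans hp.le)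
  have s1 : 1 < √(-form (u + w) (u + w)) := by rw [Real.lt_sqrt] <;> linarith
  set s := √(-form (u + w) (u + w))
  have s0 : 0 < s := by linarith
  have h4 := first_variation hmin (v := s⁻¹ • (u + w))
    (by rw [form_smul_right, hU0, mul_zero])
    (by
      rw [form_smul_right, form_smul_left, ← neg_neg (form (u + w) (u + w)), ← s2]; field_simp)
  rw [sum_zmod_three _ i, hi, dir_self, if_pos rfl, if_neg h1, if_neg h2, ← hu, ← hw, form_zero_right] at h4
  have h5 : form (s⁻¹ • (u + w)) u + form (s⁻¹ • (u + w)) w = -s := by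
    rw [← form_add_right, form_smul_left, ← neg_neg (form (u + w) (u + w)), ← s2]; field_simp
  linarith

end FirstVariation

/-! ### Convexity of the distance -/

section Convexity

variable {n : ℕ}

/-- The midpoint of two points of hyperbolic space. -/
def mid (p q : Hyp n) : Hyp n :=
  ⟨(√(2 + 2 * form p.1 q.1))⁻¹ • (p.1 + q.1), by
    have h := one_le_form p q
    have h0 : 0 < 2 + 2 * form p.1 q.1 := by linarith
    have h1 := Real.sq_sqrt h0.le
    have h2 := Real.sqrt_pos.2 h0
    refine ⟨?_, ?_⟩
    · simp only [form_smul_left, form_smul_right, form_add_left, form_add_right, form_self,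
        form_comm q.1 p.1]
      rw [← mul_add, ← mul_assoc, ← sq, inv_pow, h1, inv_mul_eq_iff_eq_mul₀ h0.ne']
      ring
    · exact mul_pos (inv_pos.2 h2) (add_pos p.2.2 q.2.2)⟩

theorem mid_comm (p q : Hyp n) : mid p q = mid q p := by
  apply Subtype.ext; simp only [mid, form_comm p.1 q.1, add_comm p.1 q.1]

theorem smul_mid (g : Isom n) (p q : Hyp n) : g • mid p q = mid (g • p) (g • q) := by
  apply Subtype.ext
  simp only [mid, form_smul_smul]
  change g.1 _ = _ • (g.1 p.1 + g.1 q.1)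
  rw [map_smul, map_add]

theorem form_mid_mid (p q r s : Hyp n) : form (mid p q).1 (mid r s).1 =
    (form p.1 r.1 + form p.1 s.1 + form q.1 r.1 + form q.1 s.1)
      / (4 * Real.cosh (hdist p q / 2) * Real.cosh (hdist r s / 2)) := by
  have key : ∀ p q : Hyp n, √(2 + 2 * form p.1 q.1) = 2 * Real.cosh (hdist p q / 2) := by
    intro p q
    rw [← cosh_hdist, Real.sqrt_eq_iff_mul_self_eq_of_pos (by positivity)]
    have := Real.cosh_sq (hdist p q / 2)
    have h2 := Real.cosh_two_mul (hdist p q / 2)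
    rw [mul_div_cancel₀ _ two_ne_zero] at h2
    nlinarith
  simp only [mid, form_smul_left, form_smul_right, form_add_left, form_add_right, key]
  have h1 := (Real.cosh_pos (hdist p q / 2)).ne'
  have h2 := (Real.cosh_pos (hdist r s / 2)).ne'
  field_simp
  ring

/-- Three points lie on one geodesic: their Gram determinant vanishes. -/
def Collinear (x y z : Hyp n) : Prop :=
  1 + 2 * form x.1 y.1 * form y.1 z.1 * form x.1 z.1
    = form x.1 y.1 ^ 2 + form y.1 z.1 ^ 2 + form x.1 z.1 ^ 2

/-- The segment between the midpoints of two sides of a triangle is at most half the third side. -/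
theorem hdist_mid_le (x y z : Hyp n) :
    hdist (mid y x) (mid y z) ≤ hdist x z / 2 ∧
      (hdist (mid y x) (mid y z) = hdist x z / 2 → Collinear x y z) := by
  have hg := gram_nonneg x y z
  have hcosh : ∀ p q : Hyp n, form p.1 q.1 = 2 * Real.cosh (hdist p q / 2) ^ 2 - 1 := by
    intro p q
    have := Real.cosh_sq (hdist p q / 2)
    have h2 := Real.cosh_two_mul (hdist p q / 2)
    rw [mul_div_cancel₀ _ two_ne_zero, cosh_hdist] at h2
    linarith
  have hf := form_mid_mid y x y z
  rw [form_self, hdist_comm y x] at hf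
  have hA := Real.cosh_pos (hdist x y / 2)
  have hB := Real.cosh_pos (hdist y z / 2)
  have hC := Real.cosh_pos (hdist x z / 2)
  unfold Collinear
  rw [hcosh x y, hcosh y z, hcosh x z] at hg hf ⊢
  rw [eq_div_iff (by positivity)] at hf
  have hn := hdist_nonneg (mid y x) (mid y z)
  have hn' := hdist_nonneg x z
  rw [← cosh_hdist] at hf
  constructor
  · rw [← abs_of_nonneg hn, ← abs_of_nonneg (by linarith : 0 ≤ hdist x z / 2), ← Real.cosh_le_cosh]
    set A := Real.cosh (hdist x y / 2)
    set B := Real.cosh (hdist y z / 2)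
    set C := Real.cosh (hdist x z / 2)
    set M := Real.cosh (hdist (mid y x) (mid y z))
    have h1 : (A ^ 2 + B ^ 2 + C ^ 2 - 1) ^ 2 ≤ (2 * A * B * C) ^ 2 := by linarith
    have h2 := abs_le_of_sq_le_sq' h1 (by positivity)
    have h3 : (4 * A * B) * M ≤ (4 * A * B) * C := by linarith [h2.2]
    exact le_of_mul_le_mul_left h3 (by positivity)
  · intro h
    rw [h] at hf
    set A := Real.cosh (hdist x y / 2)
    set B := Real.cosh (hdist y z / 2)
    set C := Real.cosh (hdist x z / 2)
    have h1 : A ^ 2 + B ^ 2 + C ^ 2 - 1 = 2 * A * B * C := by linarith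
    have h2 : (A ^ 2 + B ^ 2 + C ^ 2 - 1) ^ 2 = (2 * A * B * C) ^ 2 := by rw [h1]
    linarith

/-- Midpoint convexity of the distance, by way of the midpoint of `p'` and `q`. -/
theorem hdist_mid_mid_le (p p' q q' : Hyp n) :
    hdist (mid p p') (mid q q') ≤ (hdist p q + hdist p' q') / 2 ∧
      (hdist (mid p p') (mid q q') = (hdist p q + hdist p' q') / 2 → Collinear p p' q) := by
  have h1 := hdist_mid_le p p' q
  have h2 := hdist_mid_le p' q q'
  have h3 := hdist_triangle (mid p p') (mid p' q) (mid q q')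
  rw [mid_comm p' p] at h1
  rw [mid_comm q p'] at h2
  refine ⟨by linarith [h1.1, h2.1], fun h => h1.2 ?_⟩
  linarith [h1.1, h2.1]

/-- Three unit vectors with sum zero are not all tangent to one line. -/
theorem eq_of_collinear {p p' : Hyp n} {q : ZMod 3 → Hyp n} (hne : ∀ i, p ≠ q i)
    (hsum : ∑ i, dir p (q i) = 0) (hcol : ∀ i, Collinear p p' (q i)) : p = p' := by
  by_contra hpp
  have ha := one_lt_form hpp
  have hs : 0 < √(form p.1 p'.1 ^ 2 - 1) := Real.sqrt_pos.2 (by nlinarith)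
  have hs2 := Real.sq_sqrt (by nlinarith : 0 ≤ form p.1 p'.1 ^ 2 - 1)
  set s := √(form p.1 p'.1 ^ 2 - 1)
  have key : ∀ i, form p'.1 (dir p (q i)) = s ∨ form p'.1 (dir p (q i)) = -s := by
    intro i
    rw [← sq_eq_sq_iff_eq_or_eq_neg, hs2, dir, form_smul_right, form_sub_right, form_smul_right,
      mul_pow, inv_pow]
    have hc := one_lt_form (hne i)
    have hc' : 0 < form p.1 (q i).1 ^ 2 - 1 := by nlinarith
    rw [Real.sq_sqrt hc'.le, inv_mul_eq_iff_eq_mul₀ hc'.ne']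
    have := hcol i
    unfold Collinear at this
    rw [form_comm p'.1 p.1]
    linarith
  have h0 := congrArg (form p'.1) hsum
  rw [form_sum_right, form_zero_right] at h0
  rw [sum_zmod_three _ 0] at h0
  rcases key 0 with e0 | e0 <;> rcases key (0 + 1) with e1 | e1 <;> rcases key (0 + 2) with e2 | e2 <;>
    rw [e0, e1, e2] at h0 <;> linarith

end Convexity

/-! ### The length function on pairs of vertices -/

section ThetaLength

variable {n : ℕ}

/-- The total length of the theta graph whose vertices lift to `p` and `q`, and whose edges lift to
the geodesics from `p` to the points `a i • q`. -/
def thetaLength (a : ZMod 3 → Isom n) (p q : Hyp n) : ℝ := ∑ i, hdist p (a i • q)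

theorem thetaLength_swap (a : ZMod 3 → Isom n) (p q : Hyp n) :
    thetaLength a p q = thetaLength (fun i => (a i)⁻¹) q p :=
  Finset.sum_congr rfl fun i _ => by rw [hdist_smul_right, hdist_comm]

/-- The pair `(p, q)` minimizes the length function. -/
def IsMinimal (a : ZMod 3 → Isom n) (p q : Hyp n) : Prop :=
  ∀ p' q', thetaLength a p q ≤ thetaLength a p' q'

theorem IsMinimal.swap {a : ZMod 3 → Isom n} {p q : Hyp n} (h : IsMinimal a p q) :
    IsMinimal (fun i => (a i)⁻¹) q p := by
  intro q' p'
  rw [← thetaLength_swap, ← thetaLength_swap]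
  exact h p' q'

theorem IsMinimal.sum_dir {a : ZMod 3 → Isom n} {p q : Hyp n} (h : IsMinimal a p q)
    (hne : ∀ i, p ≠ a i • q) : ∑ i, dir p (a i • q) = 0 :=
  sum_dir_eq_zero (fun x => h x q) hne

/-- The midpoints of two minima are again a minimum, so that convexity holds with equality. -/
theorem IsMinimal.left_unique {a : ZMod 3 → Isom n} {p q p' q' : Hyp n} (h : IsMinimal a p q)
    (h' : IsMinimal a p' q') (hne : ∀ i, p ≠ a i • q) : p = p' := by
  refine eq_of_collinear hne (h.sum_dir hne) ?_
  have hle : ∀ i ∈ Finset.univ, hdist (mid p p') (a i • mid q q')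
      ≤ (hdist p (a i • q) + hdist p' (a i • q')) / 2 := by
    intro i _
    rw [smul_mid]
    exact (hdist_mid_mid_le p p' (a i • q) (a i • q')).1
  have heq : ∑ i, hdist (mid p p') (a i • mid q q')
      = ∑ i, (hdist p (a i • q) + hdist p' (a i • q')) / 2 := by
    apply le_antisymm (Finset.sum_le_sum hle)
    rw [← Finset.sum_div, Finset.sum_add_distrib]
    have h1 := h (mid p p') (mid q q')
    have h2 := h' (mid p p') (mid q q')
    unfold thetaLength at h1 h2
    linarith
  intro i
  have := (Finset.sum_eq_sum_iff_of_le hle).1 heq i (Finset.mem_univ i)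
  rw [smul_mid] at this
  exact (hdist_mid_mid_le p p' (a i • q) (a i • q')).2 this

theorem IsMinimal.unique {a : ZMod 3 → Isom n} {p q p' q' : Hyp n} (h : IsMinimal a p q)
    (h' : IsMinimal a p' q') (hne : ∀ i, p ≠ a i • q) : p = p' ∧ q = q' :=
  ⟨h.left_unique h' hne, h.swap.left_unique h'.swap fun i hi => hne i (by rw [hi, smul_inv_smul])⟩

end ThetaLength

/-! ### Long cuffs exclude degenerate minima -/

section Nondegenerate

variable {n : ℕ}

/-- The isometry `g` translates some geodesic (through `z`) by the length `ℓ`. -/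
def HasTranslationLength (g : Isom n) (ℓ : ℝ) : Prop :=
  ∃ z : Hyp n, ∀ m : ℕ, hdist z (g ^ m • z) = m * ℓ

theorem le_of_forall_nat_mul_le {x y c : ℝ} (h : ∀ m : ℕ, m * x ≤ c + m * y) : x ≤ y := by
  by_contra hxy
  push Not at hxy
  obtain ⟨m, hm⟩ := exists_nat_gt (c / (x - y))
  have := h m
  rw [div_lt_iff₀ (by linarith)] at hm
  nlinarith

theorem hdist_pow_smul_le (g : Isom n) (p : Hyp n) (m : ℕ) :
    hdist p (g ^ m • p) ≤ m * hdist p (g • p) := by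
  induction m with
  | zero => rw [pow_zero, one_smul, hdist_eq_zero_iff.2 rfl]; simp
  | succ m ih =>
    have h := hdist_triangle p (g ^ m • p) (g ^ (m + 1) • p)
    rw [pow_succ g m, mul_smul, hdist_smul_smul] at h
    rw [pow_succ g m, mul_smul]
    push_cast
    linarith

theorem HasTranslationLength.le_hdist {g : Isom n} {ℓ : ℝ} (hg : HasTranslationLength g ℓ)
    (p : Hyp n) : ℓ ≤ hdist p (g • p) := by
  obtain ⟨z, hz⟩ := hg
  refine le_of_forall_nat_mul_le (c := hdist z p + hdist p z) fun m => ?_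
  have h1 := hdist_triangle z p (g ^ m • z)
  have h2 := hdist_triangle p (g ^ m • p) (g ^ m • z)
  rw [hdist_smul_smul] at h2
  linarith [hz m, hdist_pow_smul_le g p m]

/-- The words `1, A, AB⁻¹, AB⁻¹A, …`. -/
def altWord (A B : Isom n) : ℕ → Isom n
  | 0 => 1
  | k + 1 => altWord A B k * if Even k then A else B⁻¹

theorem altWord_two_mul (A B : Isom n) (m : ℕ) : altWord A B (2 * m) = (A * B⁻¹) ^ m := by
  induction m with
  | zero => rfl
  | succ m ih =>
    have h1 : ¬ Even (2 * m + 1) := by rw [Nat.not_even_iff_odd]; exact ⟨m, rfl⟩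
    rw [mul_add, mul_one, altWord, altWord, ih, if_pos (even_two_mul m), if_neg h1, pow_succ,
      mul_assoc]

/-- The points `p, A p, AB⁻¹ p, AB⁻¹A p, …` are the vertices of a broken geodesic, in which only two
angles occur. -/
theorem pow_le_form_alternating {A B : Isom n} {p : Hyp n} {C : ℝ} (hC : 8 ≤ C)
    (hA : C ≤ form p.1 (A • p).1) (hB : C ≤ form p.1 (B • p).1)
    (h₁ : 1 / 2 ≤ form (dir p (A • p)) (dir p (B • p)))
    (h₂ : 1 / 2 ≤ form (dir p (A⁻¹ • p)) (dir p (B⁻¹ • p))) (m : ℕ) :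
    C ^ (2 * m) ≤ form p.1 ((A * B⁻¹) ^ m • p).1 := by
  have h := pow_le_form_of_angles (x := fun k => altWord A B k • p) hC ?_ ?_ (2 * m)
  · rw [altWord_two_mul] at h
    simpa only [altWord, one_smul] using h
  · intro k
    rw [altWord, mul_smul, form_smul_smul]
    split_ifs
    · exact hA
    · rwa [← form_smul_inv, form_comm]
  · intro k
    set w := altWord A B (k + 1) with hw
    set s := if Even k then A else B⁻¹ with hs
    have hprev : altWord A B k • p = w • s⁻¹ • p := by
      rw [hw, altWord, mul_smul, smul_inv_smul]
    have hnext : altWord A B (k + 2) • p = w • (if Even (k + 1) then A else B⁻¹) • p := by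
      rw [hw, altWord, mul_smul]
    rw [hprev, hnext, dir_smul, dir_smul, form_map]
    rcases Nat.even_or_odd k with hk | hk
    · have hk' : ¬ Even (k + 1) := by rw [Nat.not_even_iff_odd]; exact hk.add_one
      rw [hs, if_pos hk, if_neg hk']
      exact h₂
    · rw [hs, if_neg (Nat.not_even_iff_odd.2 hk), if_pos hk.add_one, inv_inv, form_comm]
      exact h₁

theorem four_le_exp_two : (4 : ℝ) ≤ Real.exp 2 := by
  have h := Real.exp_one_gt_d9
  have h2 : Real.exp 2 = Real.exp 1 * Real.exp 1 := by rw [← Real.exp_add]; norm_num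
  nlinarith

/-- In the situation of `pow_le_form_alternating`, the translation length of `AB⁻¹` is at least the
length of the two edges up to a constant. -/
theorem not_degenerate_angles {A B : Isom n} {p : Hyp n} {R ℓ : ℝ} (hR : 4 < R)
    (hA : 2 * R - 2 ≤ hdist p (A • p)) (hB : 2 * R - 2 ≤ hdist p (B • p))
    (hAB : HasTranslationLength (A * B⁻¹) ℓ) (hℓ : ℓ < 2 * R + 2)
    (h₁ : 1 / 2 ≤ form (dir p (A • p)) (dir p (B • p))) :
    form (dir p (A⁻¹ • p)) (dir p (B⁻¹ • p)) < 1 / 2 := by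
  by_contra! h₂
  have hcosh : ∀ x : Hyp n, 2 * R - 2 ≤ hdist p x → Real.cosh (2 * R - 2) ≤ form p.1 x.1 := by
    intro x hx
    rw [← cosh_hdist, Real.cosh_le_cosh, abs_of_nonneg (by linarith), abs_of_nonneg (by linarith)]
    exact hx
  -- `cosh (2R - 2) ≥ exp (2R - 3)`
  have hlow : Real.exp (2 * R - 3) ≤ Real.cosh (2 * R - 2) := by
    have h1 : Real.exp (2 * R - 2) = Real.exp (2 * R - 3) * Real.exp 1 := by
      rw [← Real.exp_add]; ring_nf
    have h2 := Real.exp_one_gt_d9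
    have h3 := Real.exp_pos (2 * R - 3)
    have h4 := Real.exp_pos (-(2 * R - 2))
    rw [Real.cosh_eq, h1]
    nlinarith
  have h8 : 8 ≤ Real.cosh (2 * R - 2) := by
    have h1 : Real.exp 2 * Real.exp 2 ≤ Real.exp (2 * R - 3) := by
      rw [← Real.exp_add, Real.exp_le_exp]; linarith
    have := four_le_exp_two
    nlinarith
  obtain ⟨z, hz⟩ := hAB
  have key : 2 * (2 * R - 3) ≤ ℓ := by
    refine le_of_forall_nat_mul_le (c := hdist p z + hdist z p) fun m => ?_
    have h3 := pow_le_form_alternating h8 (hcosh _ hA) (hcosh _ hB) h₁ h₂ m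
    have h4 := hdist_triangle p z ((A * B⁻¹) ^ m • p)
    have h5 := hdist_triangle z ((A * B⁻¹) ^ m • z) ((A * B⁻¹) ^ m • p)
    rw [hdist_smul_smul, hz] at h5
    have h6 : Real.exp (m * (2 * (2 * R - 3))) ≤ Real.exp (hdist p ((A * B⁻¹) ^ m • p)) := by
      calc Real.exp (m * (2 * (2 * R - 3))) = Real.exp (2 * R - 3) ^ (2 * m) := by
            rw [← Real.exp_nat_mul]; push_cast; ring_nf
        _ ≤ Real.cosh (2 * R - 2) ^ (2 * m) := by gcongr
        _ ≤ _ := h3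
        _ = Real.cosh (hdist p ((A * B⁻¹) ^ m • p)) := (cosh_hdist _ _).symm
        _ ≤ _ := by
          rw [Real.cosh_eq]
          have : Real.exp (-hdist p ((A * B⁻¹) ^ m • p))
              ≤ Real.exp (hdist p ((A * B⁻¹) ^ m • p)) :=
            Real.exp_le_exp.2 (by linarith [hdist_nonneg p ((A * B⁻¹) ^ m • p)])
          linarith
    have h7 := Real.exp_le_exp.1 h6
    linarith
  linarith

/-- At a minimum of the length function no edge has length zero, if the three cuffs are long and of
comparable lengths. -/
theorem IsMinimal.ne_smul {a : ZMod 3 → Isom n} {p q : Hyp n} (h : IsMinimal a p q) {R : ℝ}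
    (hR : 4 < R) {ℓ : ZMod 3 → ℝ}
    (htr : ∀ i, HasTranslationLength (a i * (a (i + 1))⁻¹) (ℓ i))
    (hlow : ∀ i, 2 * R - 2 < ℓ i) (hup : ∀ i, ℓ i < 2 * R + 2) (i : ZMod 3) : p ≠ a i • q := by
  intro hp
  have e2 : i + 1 + 1 = i + 2 := by rw [add_assoc]; rfl
  have e3 : i + 2 + 1 = i := by rw [add_assoc]; exact add_zero i
  have t0 := htr i
  have t1 := htr (i + 1)
  have t2 := htr (i + 2)
  rw [e2] at t1
  rw [e3] at t2
  set A := a (i + 1) * (a i)⁻¹ with hA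
  set B := a (i + 2) * (a i)⁻¹ with hB
  have hAp : A • p = a (i + 1) • q := by rw [hp, hA, mul_smul, inv_smul_smul]
  have hBp : B • p = a (i + 2) • q := by rw [hp, hB, mul_smul, inv_smul_smul]
  have hAi : a i * (a (i + 1))⁻¹ = A⁻¹ := by rw [hA]; group
  have hBi : a i * (a (i + 2))⁻¹ = B⁻¹ := by rw [hB]; group
  have hABi : a (i + 1) * (a (i + 2))⁻¹ = A * B⁻¹ := by rw [hA, hB]; group
  have lA : 2 * R - 2 ≤ hdist p (A • p) := by
    have h0 := t0.le_hdist p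
    rw [hAi, hdist_smul_right, inv_inv, hdist_comm] at h0
    linarith [hlow i]
  have lB : 2 * R - 2 ≤ hdist p (B • p) := (hlow _).le.trans (t2.le_hdist p)
  have pos : ∀ x, 2 * R - 2 ≤ hdist p x → p ≠ x := by
    intro x hx h0
    rw [hdist_eq_zero_iff.2 h0] at hx
    linarith
  have h₁ := half_le_form_dir (i := i) (fun x => h x q) hp.symm (hAp ▸ pos _ lA)
    (hBp ▸ pos _ lB)
  have inv_ne : ∀ j, p ≠ a j • q → q ≠ (a j)⁻¹ • p := fun j hj h' =>
    hj (by rw [h', smul_inv_smul])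
  have h₂ := half_le_form_dir (i := i) (fun x => h.swap x p) (by rw [hp, inv_smul_smul])
    (inv_ne _ (hAp ▸ pos _ lA)) (inv_ne _ (hBp ▸ pos _ lB))
  rw [← form_map (a i), ← dir_smul, ← dir_smul, ← hp, ← mul_smul, ← mul_smul, hAi, hBi] at h₂
  rw [← hAp, ← hBp] at h₁
  rw [hABi] at t1
  exact absurd (not_degenerate_angles hR lA lB t1 (hup _) h₁) (not_lt.2 h₂)

end Nondegenerate

/-! ### Topology of hyperbolic space and of its quotients -/

section Topology

open Topology

variable {n : ℕ}

/-- Forgetting the time coordinate identifies the hyperboloid with Euclidean space. -/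
def spaceHomeomorph (n : ℕ) : Hyp n ≃ₜ EuclideanSpace ℝ (Fin n) where
  toFun p := p.1.2
  invFun y := ⟨(√(1 + ‖y‖ ^ 2), y), by
    have h : 0 < 1 + ‖y‖ ^ 2 := by positivity
    refine ⟨?_, Real.sqrt_pos.2 h⟩
    simp only [form, real_inner_self_eq_norm_sq]
    rw [Real.mul_self_sqrt h.le]; ring⟩
  left_inv p := by
    apply Subtype.ext
    refine Prod.ext ?_ rfl
    have h := p.2.1
    have h0 := p.2.2
    simp only [form, real_inner_self_eq_norm_sq] at h
    change √(1 + ‖p.1.2‖ ^ 2) = p.1.1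
    rw [Real.sqrt_eq_iff_mul_self_eq_of_pos h0]; linarith
  right_inv y := rfl
  continuous_toFun := continuous_snd.comp continuous_subtype_val
  continuous_invFun := by
    apply Continuous.subtype_mk
    fun_prop

instance : T2Space (Hyp n) := inferInstanceAs (T2Space {x : Mink n // IsHyp x})

instance : LocallyCompactSpace (Hyp n) :=
  (spaceHomeomorph n).isClosedEmbedding.locallyCompactSpace

instance : ContractibleSpace (Hyp n) :=
  (spaceHomeomorph n).toHomotopyEquiv.contractibleSpace

theorem continuous_isom (g : Isom n) : Continuous fun p : Hyp n => g • p := by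
  have h : Continuous g.1 := (g.1 : Mink n →ₗ[ℝ] Mink n).continuous_of_finiteDimensional
  exact Continuous.subtype_mk (h.comp continuous_subtype_val) _

/-- The points at bounded distance from `q` have bounded time coordinate. -/
theorem time_le (p q : Hyp n) : p.1.1 ≤ 2 * q.1.1 * form p.1 q.1 := by
  have hp := p.2.1
  have hq := q.2.1
  have hp0 := p.2.2
  have hq0 := q.2.2
  have h := real_inner_le_norm p.1.2 q.1.2
  simp only [form, real_inner_self_eq_norm_sq] at hp hq ⊢
  have h1 : ‖p.1.2‖ ≤ p.1.1 := by
    apply le_of_pow_le_pow_left₀ two_ne_zero hp0.le; nlinarith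
  have h2 : ‖q.1.2‖ ≤ q.1.1 := by
    apply le_of_pow_le_pow_left₀ two_ne_zero hq0.le; nlinarith
  have h3 : p.1.1 * (q.1.1 - ‖q.1.2‖) ≤ p.1.1 * q.1.1 - inner ℝ p.1.2 q.1.2 := by
    nlinarith [norm_nonneg q.1.2]
  have h4 : 1 ≤ 2 * q.1.1 * (q.1.1 - ‖q.1.2‖) := by nlinarith [norm_nonneg q.1.2]
  nlinarith

/-- A set at bounded distance from a compact set is contained in a compact set. -/
theorem exists_compact_of_hdist_le {K : Set (Hyp n)} (hK : IsCompact K) (C : ℝ) :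
    ∃ L : Set (Hyp n), IsCompact L ∧ ∀ p, ∀ q ∈ K, hdist q p ≤ C → p ∈ L := by
  have hc : Continuous fun q : Hyp n => q.1.1 := continuous_fst.comp continuous_subtype_val
  obtain ⟨M, hM⟩ := (hK.image hc).bddAbove
  refine ⟨spaceHomeomorph n ⁻¹' Metric.closedBall 0 (2 * M * Real.cosh C),
    (spaceHomeomorph n).isCompact_preimage.2 (isCompact_closedBall _ _), fun p q hq h => ?_⟩
  have h1 := hM ⟨q, hq, rfl⟩
  have h2 := time_le p q
  have h3 : form p.1 q.1 ≤ Real.cosh C := by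
    rw [form_comm, ← cosh_hdist, Real.cosh_le_cosh, abs_of_nonneg (hdist_nonneg q p)]
    exact h.trans (le_abs_self C)
  have h4 := form_pos p q
  have hq0 := q.2.2
  rw [Set.mem_preimage, mem_closedBall_zero_iff]
  change ‖p.1.2‖ ≤ _
  have hp := p.2.1
  have hp0 := p.2.2
  simp only [form, real_inner_self_eq_norm_sq] at hp
  have h5 : ‖p.1.2‖ ≤ p.1.1 := by
    apply le_of_pow_le_pow_left₀ two_ne_zero hp0.le; nlinarith
  have h1' : q.1.1 ≤ M := h1
  have hM0 : 0 ≤ 2 * M := by linarith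
  calc ‖p.1.2‖ ≤ 2 * q.1.1 * form p.1 q.1 := h5.trans h2
    _ ≤ 2 * M * Real.cosh C := by gcongr

variable {Γ : Subgroup (Isom n)}

instance : ContinuousConstSMul Γ (Hyp n) := ⟨fun g => continuous_isom g.1⟩

theorem IsClosedHyperbolic.isCancelSMul (hΓ : IsClosedHyperbolic Γ) : IsCancelSMul Γ (Hyp n) :=
  isCancelSMul_iff_eq_one_of_smul_eq.2 fun g x h => Subtype.ext (hΓ.free g.1 g.2 x h)

theorem IsClosedHyperbolic.isQuotientCoveringMap (hΓ : IsClosedHyperbolic Γ) :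
    IsQuotientCoveringMap (proj Γ) Γ :=
  haveI := hΓ.properlyDiscontinuous
  haveI := hΓ.isCancelSMul
  isQuotientCoveringMap_quotientMk_of_properlyDiscontinuousSMul

theorem IsClosedHyperbolic.exists_compact (hΓ : IsClosedHyperbolic Γ) :
    ∃ K : Set (Hyp n), IsCompact K ∧ ∀ x, ∃ g : Γ, g • x ∈ K := by
  have hq := hΓ.isQuotientCoveringMap
  have := hΓ.compact
  have hopen : IsOpenMap (proj Γ) := hq.isOpenQuotientMap.isOpenMap
  choose r hr using hq.surjective
  choose N hN hN' using fun x : Hyp n => exists_compact_mem_nhds x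
  obtain ⟨t, ht⟩ := CompactSpace.elim_nhds_subcover (fun y => proj Γ '' N (r y)) fun y => by
    have := hopen.image_mem_nhds (hN' (r y))
    rwa [hr] at this
  refine ⟨⋃ y ∈ t, N (r y), t.isCompact_biUnion fun y _ => hN (r y), fun x => ?_⟩
  have hx : proj Γ x ∈ ⋃ y ∈ t, proj Γ '' N (r y) := by rw [ht]; trivial
  simp only [Set.mem_iUnion] at hx ⊢
  obtain ⟨y, hy, z, hz, hzx⟩ := hx
  obtain ⟨g, hg⟩ := hq.apply_eq_iff_mem_orbit.1 hzx
  exact ⟨g, y, hy, by rw [show g • x = z from hg]; exact hz⟩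

/-- The length function attains its minimum. Both vertices can be moved to a compact set which
meets all orbits; this changes the `a i`, but by proper discontinuity only finitely many values
occur as long as the length is bounded. -/
theorem IsClosedHyperbolic.exists_isMinimal (hΓ : IsClosedHyperbolic Γ) (a : ZMod 3 → Γ) :
    ∃ p q : Hyp n, IsMinimal (fun i => (a i : Isom n)) p q := by
  obtain ⟨K, hK, hKΓ⟩ := hΓ.exists_compact
  obtain ⟨x₀⟩ : Nonempty (Hyp n) := inferInstance
  set C := thetaLength (fun i => (a i : Isom n)) x₀ x₀ with hC
  obtain ⟨L, hL, hKL⟩ := exists_compact_of_hdist_le hK C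
  have hfin := hΓ.properlyDiscontinuous.finite_disjoint_inter_image hK hL
  set T : Set (ZMod 3 → Γ) := {t | (∀ i, t i ∈ {g : Γ | ((g • ·) '' K ∩ L).Nonempty}) ∧
    ∃ γ δ : Γ, ∀ i, t i = γ * a i * δ⁻¹} with hT
  have hTfin : T.Finite := (Set.Finite.pi' fun _ => hfin).subset fun t ht => ht.1
  have hmove : ∀ γ δ : Γ, ∀ p q, thetaLength (fun i => ((γ * a i * δ⁻¹ : Γ) : Isom n))
      (γ • p) (δ • q) = thetaLength (fun i => (a i : Isom n)) p q := by
    intro γ δ p q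
    refine Finset.sum_congr rfl fun i _ => ?_
    change hdist (γ.1 • p) ((γ.1 * (a i).1 * δ.1⁻¹) • δ.1 • q) = _
    rw [mul_smul, inv_smul_smul, mul_smul, hdist_smul_smul]
  -- every pair of length at most `C` can be moved to `K × K`
  have hred : ∀ p q, thetaLength (fun i => (a i : Isom n)) p q ≤ C →
      ∃ t ∈ T, ∃ p' ∈ K, ∃ q' ∈ K, thetaLength (fun i => (t i : Isom n)) p' q'
        = thetaLength (fun i => (a i : Isom n)) p q := by
    intro p q hpq
    obtain ⟨γ, hγ⟩ := hKΓ p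
    obtain ⟨δ, hδ⟩ := hKΓ q
    refine ⟨fun i => γ * a i * δ⁻¹, ⟨fun i => ?_, γ, δ, fun i => rfl⟩, _, hγ, _, hδ,
      hmove γ δ p q⟩
    refine ⟨(γ * a i * δ⁻¹) • δ • q, ⟨_, hδ, rfl⟩, hKL _ _ hγ ?_⟩
    refine le_trans ?_ hpq
    rw [← hmove γ δ p q]
    exact Finset.single_le_sum (f := fun i => hdist (γ • p) (((γ * a i * δ⁻¹ : Γ) : Isom n) • δ • q))
      (fun j _ => hdist_nonneg _ _) (Finset.mem_univ i)
  obtain ⟨t₀, ht₀, p₀, hp₀, q₀, hq₀, h₀⟩ := hred x₀ x₀ le_rfl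
  have hcont : ∀ t : ZMod 3 → Γ, Continuous fun z : Hyp n × Hyp n =>
      thetaLength (fun i => (t i : Isom n)) z.1 z.2 := by
    intro t
    unfold thetaLength
    exact continuous_finsetSum _ fun i _ => continuous_hdist.comp
      (continuous_fst.prodMk ((continuous_isom _).comp continuous_snd))
  have hmin : ∀ t : ZMod 3 → Γ, ∃ z ∈ K ×ˢ K, ∀ y ∈ K ×ˢ K,
      thetaLength (fun i => (t i : Isom n)) z.1 z.2
        ≤ thetaLength (fun i => (t i : Isom n)) y.1 y.2 := fun t =>
    (hK.prod hK).exists_isMinOn ⟨(p₀, q₀), hp₀, hq₀⟩ (hcont t).continuousOn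
  choose z hzK hz using hmin
  obtain ⟨t, htT, ht⟩ := Set.exists_min_image T
    (fun t => thetaLength (fun i => (t i : Isom n)) (z t).1 (z t).2) hTfin ⟨t₀, ht₀⟩
  obtain ⟨-, γ, δ, htγ⟩ := id htT
  obtain rfl : t = fun i => γ * a i * δ⁻¹ := funext htγ
  set t : ZMod 3 → Γ := fun i => γ * a i * δ⁻¹ with htdef
  refine ⟨γ⁻¹ • (z t).1, δ⁻¹ • (z t).2, ?_⟩
  have hval := hmove γ δ (γ⁻¹ • (z t).1) (δ⁻¹ • (z t).2)
  rw [smul_inv_smul, smul_inv_smul] at hval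
  have hle : ∀ p q, thetaLength (fun i => (a i : Isom n)) p q ≤ C →
      thetaLength (fun i => (t i : Isom n)) (z t).1 (z t).2
        ≤ thetaLength (fun i => (a i : Isom n)) p q := by
    intro p q hpq
    obtain ⟨t', ht', p', hp', q', hq', h'⟩ := hred p q hpq
    rw [← h']
    exact (ht t' ht').trans (hz t' (p', q') ⟨hp', hq'⟩)
  intro p q
  rw [← hval]
  rcases le_total (thetaLength (fun i => (a i : Isom n)) p q) C with h | h
  · exact hle p q h
  · exact (hle x₀ x₀ le_rfl).trans h

end Topology

/-! ### Geodesics between two points -/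

section Geodesics

variable {n : ℕ}

namespace TangentVector

theorem speed_nonneg (τ : TangentVector n) : 0 ≤ τ.speed := Real.sqrt_nonneg _

theorem form_base_flow (τ : TangentVector n) (t : ℝ) :
    form τ.base.1 (τ.flow t).base.1 = Real.cosh (t * τ.speed) := by
  simp only [flow, form_add_right, form_smul_right, form_self, τ.orth]
  ring

theorem hdist_flow (τ : TangentVector n) {t : ℝ} (ht : 0 ≤ t) :
    hdist τ.base (τ.flow t).base = t * τ.speed := by
  rw [hdist, form_base_flow, Real.arcosh_cosh (mul_nonneg ht τ.speed_nonneg)]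

theorem speed_map (g : Isom n) (τ : TangentVector n) : (τ.map g).speed = τ.speed := by
  simp only [speed, map, form_map]

theorem map_mul (g h : Isom n) (τ : TangentVector n) : τ.map (g * h) = (τ.map h).map g := rfl

theorem map_one (τ : TangentVector n) : τ.map 1 = τ := rfl

theorem flow_map (g : Isom n) (τ : TangentVector n) (t : ℝ) :
    (τ.map g).flow t = (τ.flow t).map g := by
  ext1
  · apply Subtype.ext
    simp only [flow, speed_map]
    change _ • g.1 τ.base.1 + _ • g.1 τ.vec = g.1 _
    rw [map_add, map_smul, map_smul]
  · simp only [flow, speed_map]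
    change _ • g.1 τ.base.1 + _ • g.1 τ.vec = g.1 _
    rw [_root_.map_add, map_smul, map_smul]

theorem reverse_map (g : Isom n) (τ : TangentVector n) :
    (τ.map g).reverse = τ.reverse.map g := by
  ext1
  · rfl
  · change (-1 : ℝ) • g.1 τ.vec = g.1 ((-1 : ℝ) • τ.vec)
    rw [map_smul]

theorem speed_scale {a : ℝ} (τ : TangentVector n) : (τ.scale a).speed = |a| * τ.speed := by
  simp only [speed, scale, form_smul_left, form_smul_right]
  rw [← Real.sqrt_sq_eq_abs, ← Real.sqrt_mul (sq_nonneg a)]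
  congr 1; ring

theorem speed_flow (τ : TangentVector n) (t : ℝ) : (τ.flow t).speed = τ.speed := by
  have h := form_vec τ
  have h2 := Real.cosh_sq (t * τ.speed)
  have e : -form (τ.flow t).vec (τ.flow t).vec = τ.speed ^ 2 := by
    simp only [flow, form_add_left, form_add_right, form_smul_left, form_smul_right, form_self,
      τ.orth, form_comm τ.vec τ.base.1, h]
    linear_combination τ.speed ^ 2 * h2
  rw [speed, e, Real.sqrt_sq τ.speed_nonneg]

theorem flow_flow {τ : TangentVector n} (hτ : 0 < τ.speed) (s t : ℝ) :
    (τ.flow s).flow t = τ.flow (s + t) := by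
  have h := τ.speed_flow s
  have h0 := hτ.ne'
  ext1
  · apply Subtype.ext
    simp only [flow] at h ⊢
    rw [h, add_mul, Real.cosh_add, Real.sinh_add]
    match_scalars <;> field_simp
  · simp only [flow] at h ⊢
    rw [h, add_mul, Real.cosh_add, Real.sinh_add]
    match_scalars <;> field_simp <;> ring

/-- If the deck transformation `h` closes up the geodesic after one period, then it translates this
geodesic by the period. -/
theorem hasTranslationLength {τ : TangentVector n} {h : Isom n} (hτ : 0 < τ.speed)
    (hc : τ.flow 1 = τ.map h) : HasTranslationLength h τ.speed := by
  have key : ∀ m : ℕ, τ.flow m = τ.map (h ^ m) := by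
    intro m
    induction m with
    | zero =>
      rw [pow_zero, map_one]
      ext1
      · apply Subtype.ext; simp [flow]
      · simp [flow]
    | succ m ih =>
      rw [Nat.cast_succ, add_comm, ← flow_flow hτ, hc, flow_map, ih, pow_succ', map_mul]
  refine ⟨τ.base, fun m => ?_⟩
  rw [← hdist_flow τ (Nat.cast_nonneg m), key]
  rfl

end TangentVector

open TangentVector

theorem HasTranslationLength.conj {h : Isom n} {ℓ : ℝ} (hh : HasTranslationLength h ℓ)
    (g : Isom n) : HasTranslationLength (g * h * g⁻¹) ℓ := by
  obtain ⟨z, hz⟩ := hh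
  refine ⟨g • z, fun m => ?_⟩
  rw [conj_pow, mul_smul, inv_smul_smul, mul_smul, hdist_smul_smul, hz]

/-- The initial velocity of the geodesic which goes from `p` to `x` in unit time. -/
def geo (p x : Hyp n) : TangentVector n where
  base := p
  vec := hdist p x • dir p x
  orth := by rw [form_smul_right, form_dir, mul_zero]

theorem speed_geo (p x : Hyp n) : (geo p x).speed = hdist p x := by
  by_cases h : p = x
  · subst h
    simp [speed, geo, hdist_eq_zero_iff.2, form_zero_left]
  · simp only [speed, geo, form_smul_left, form_smul_right, form_dir_self h]
    rw [Real.sqrt_eq_iff_mul_self_eq] <;> nlinarith [hdist_nonneg p x]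

theorem geo_flow_one (p x : Hyp n) : ((geo p x).flow 1).base = x := by
  apply Subtype.ext
  simp only [flow, speed_geo, one_mul]
  conv_rhs => rw [eq_cosh_add_sinh p x]
  by_cases h : p = x
  · subst h
    simp [geo, dir_self]
  · have := (hdist_pos h).ne'
    simp only [geo, smul_smul]
    rw [div_mul_cancel₀ _ this]

/-- A geodesic is determined by its endpoints. -/
theorem eq_geo {τ : TangentVector n} {x : Hyp n} (h : (τ.flow 1).base = x) :
    τ = geo τ.base x := by
  have hd := hdist_flow τ zero_le_one
  rw [h, one_mul] at hd
  ext1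
  · rfl
  · simp only [geo]
    rw [hd]
    rcases eq_or_ne τ.speed 0 with h0 | h0
    · rw [h0, zero_smul]
      refine eq_zero_of_tangent τ.orth ?_
      rw [form_vec, h0]; ring
    · have h1 := congrArg Subtype.val h
      simp only [flow, one_mul] at h1
      rw [eq_cosh_add_sinh τ.base x, hd] at h1
      have h2 := add_left_cancel h1
      have hs : Real.sinh τ.speed ≠ 0 := Real.sinh_ne_zero.2 h0
      rw [div_eq_mul_inv, mul_smul] at h2
      have h3 := smul_right_injective _ hs h2
      rw [← h3, smul_inv_smul₀ h0]

theorem map_geo (g : Isom n) (p x : Hyp n) : (geo p x).map g = geo (g • p) (g • x) := by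
  refine eq_geo (τ := (geo p x).map g) ?_
  rw [flow_map]
  change g • ((geo p x).flow 1).base = _
  rw [geo_flow_one]

theorem reverse_flow_flow (τ : TangentVector n) : ((τ.flow 1).reverse.flow 1).base = τ.base := by
  have h : (τ.flow 1).reverse.speed = τ.speed := by
    rw [reverse, speed_scale, speed_flow]; simp
  apply Subtype.ext
  have hcs := Real.cosh_sq τ.speed
  simp only [flow, reverse, scale] at h ⊢
  rw [h]
  simp only [one_mul]
  rcases eq_or_ne τ.speed 0 with h0 | h0
  · simp [h0]
  · have e : Real.cosh τ.speed * Real.cosh τ.speed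
      - Real.sinh τ.speed / τ.speed * (τ.speed * Real.sinh τ.speed) = 1 := by
      field_simp; linarith
    match_scalars
    · linarith
    · field_simp; ring

theorem reverse_geo_flow (p x : Hyp n) : ((geo p x).flow 1).reverse = geo x p := by
  have h := eq_geo (reverse_flow_flow (geo p x))
  rw [h]
  change geo ((geo p x).flow 1).base p = _
  rw [geo_flow_one]

end Geodesics

/-! ### Angles of directions with sum zero -/

section Angles

variable {n : ℕ}

open TangentVector

theorem form_dir_eq_half {p : Hyp n} {x : ZMod 3 → Hyp n} (hne : ∀ i, p ≠ x i)
    (hsum : ∑ i, dir p (x i) = 0) {i j : ZMod 3} (hij : i ≠ j) :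
    form (dir p (x i)) (dir p (x j)) = 1 / 2 := by
  have e := fun i => form_dir_self (hne i)
  have h : ∀ k, form (dir p (x k)) (dir p (x i)) + form (dir p (x k)) (dir p (x (i + 1)))
      + form (dir p (x k)) (dir p (x (i + 2))) = 0 := by
    intro k
    rw [← sum_zmod_three (fun j => form (dir p (x k)) (dir p (x j))) i, ← form_sum_right, hsum,
      form_zero_right]
  have h0 := h i
  have h1 := h (i + 1)
  have h2 := h (i + 2)
  rw [e] at h0 h1 h2
  rw [form_comm (dir p (x (i + 1))) (dir p (x i))] at h1
  rw [form_comm (dir p (x (i + 2))) (dir p (x i)),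
    form_comm (dir p (x (i + 2))) (dir p (x (i + 1)))] at h2
  have hj : ∀ i j : ZMod 3, i ≠ j → j = i + 1 ∨ j = i + 2 := by decide
  obtain rfl | rfl := hj i j hij
  · linarith
  · linarith

theorem arccos_neg_half : Real.arccos (-(1 / 2)) = 2 * Real.pi / 3 := by
  rw [Real.arccos_neg, ← Real.cos_pi_div_three,
    Real.arccos_cos (by positivity) (by linarith [Real.pi_pos])]
  ring

theorem angle_map (g : Isom n) (τ σ : TangentVector n) :
    (τ.map g).angle (σ.map g) = τ.angle σ := by
  simp only [angle, speed_map]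
  simp only [map, form_map]

theorem angle_geo {p : Hyp n} {x : ZMod 3 → Hyp n} (hne : ∀ i, p ≠ x i)
    (hsum : ∑ i, dir p (x i) = 0) {i j : ZMod 3} (hij : i ≠ j) :
    (geo p (x i)).angle (geo p (x j)) = 2 * Real.pi / 3 := by
  rw [angle, speed_geo, speed_geo, ← arccos_neg_half]
  simp only [geo, form_smul_left, form_smul_right, form_dir_eq_half hne hsum hij]
  have := (hdist_pos (hne i)).ne'
  have := (hdist_pos (hne j)).ne'
  congr 1
  field_simp

theorem speed_unit {τ : TangentVector n} (hτ : 0 < τ.speed) : τ.unit.speed = 1 := by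
  rw [unit, speed_scale, abs_of_pos (inv_pos.2 hτ), inv_mul_cancel₀ hτ.ne']

theorem angle_unit {τ σ : TangentVector n} (hτ : 0 < τ.speed) (hσ : 0 < σ.speed) :
    τ.unit.angle σ.unit = τ.angle σ := by
  rw [angle, speed_unit hτ, speed_unit hσ, angle]
  simp only [unit, scale, form_smul_left, form_smul_right]
  congr 1
  field_simp

theorem isTripod_unit {τ : ZMod 3 → TangentVector n} (hbase : ∀ i j, (τ i).base = (τ j).base)
    (hpos : ∀ i, 0 < (τ i).speed) (hang : ∀ i j, i ≠ j → (τ i).angle (τ j) = 2 * Real.pi / 3) :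
    IsTripod fun i => (τ i).unit :=
  ⟨hbase, fun i => speed_unit (hpos i), fun i j hij => by
    rw [angle_unit (hpos i) (hpos j), hang i j hij]⟩

end Angles

/-! ### Lifting homotopy classes of paths -/

section Lifting

variable {n : ℕ} {Γ : Subgroup (Isom n)}

/-- The class `a` of paths in `Γ \ ℍⁿ` is represented by the projection of a path from `x` to `y`
in `ℍⁿ`. -/
def Lifts {A B : Mfd Γ} (a : PathClass A B) (x y : Hyp n) : Prop :=
  ∃ (c : Path x y) (d : Path A B), Path.Homotopic.Quotient.mk d = a ∧ ∀ t, d t = proj Γ (c t)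

variable {A B C : Mfd Γ}

theorem proj_smul {g : Isom n} (hg : g ∈ Γ) (x : Hyp n) : proj Γ (g • x) = proj Γ x :=
  Quotient.sound ⟨⟨g, hg⟩, rfl⟩

theorem exists_smul_eq {x y : Hyp n} (h : proj Γ x = proj Γ y) : ∃ g ∈ Γ, g • x = y := by
  obtain ⟨g, hg⟩ := Quotient.exact h.symm
  exact ⟨g.1, g.2, hg⟩

theorem continuous_proj : Continuous (proj Γ) := continuous_quotient_mk'

theorem Lifts.source {a : PathClass A B} {x y : Hyp n} (h : Lifts a x y) : proj Γ x = A := by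
  obtain ⟨c, d, -, hd⟩ := h
  simpa using (hd 0).symm

theorem Lifts.target {a : PathClass A B} {x y : Hyp n} (h : Lifts a x y) : proj Γ y = B := by
  obtain ⟨c, d, -, hd⟩ := h
  simpa using (hd 1).symm

theorem Lifts.trans {a : PathClass A B} {b : PathClass B C} {x y z : Hyp n} (ha : Lifts a x y)
    (hb : Lifts b y z) : Lifts (a.trans b) x z := by
  obtain ⟨c, d, rfl, hd⟩ := ha
  obtain ⟨c', d', rfl, hd'⟩ := hb
  refine ⟨c.trans c', d.trans d', rfl, fun t => ?_⟩
  rw [Path.trans_apply, Path.trans_apply]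
  split_ifs
  · exact hd _
  · exact hd' _

theorem Lifts.symm {a : PathClass A B} {x y : Hyp n} (ha : Lifts a x y) : Lifts a.symm y x := by
  obtain ⟨c, d, rfl, hd⟩ := ha
  exact ⟨c.symm, d.symm, rfl, fun t => hd _⟩

theorem Lifts.smul {a : PathClass A B} {x y : Hyp n} (ha : Lifts a x y) {g : Isom n}
    (hg : g ∈ Γ) : Lifts a (g • x) (g • y) := by
  obtain ⟨c, d, rfl, hd⟩ := ha
  exact ⟨c.map (continuous_isom g), d, rfl, fun t => by rw [hd, Path.map_coe, Function.comp,
    proj_smul hg]⟩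

theorem Lifts.refl {x : Hyp n} (hx : proj Γ x = A) :
    Lifts (Path.Homotopic.Quotient.refl A) x x :=
  ⟨Path.refl x, Path.refl _, rfl, fun _ => hx.symm⟩

/-- Hyperbolic space is simply connected, so a class of paths is determined by the endpoints of a
lift. -/
theorem Lifts.eq {a b : PathClass A B} {x y : Hyp n} (ha : Lifts a x y) (hb : Lifts b x y) :
    a = b := by
  obtain rfl := ha.source
  obtain rfl := ha.target
  obtain ⟨c, d, rfl, hd⟩ := ha
  obtain ⟨c', d', rfl, hd'⟩ := hb
  obtain rfl : d = c.map continuous_proj := Path.ext (funext hd)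
  obtain rfl : d' = c'.map continuous_proj := Path.ext (funext hd')
  exact Path.Homotopic.Quotient.eq.2
    ((SimplyConnectedSpace.paths_homotopic c c').map ⟨proj Γ, continuous_proj⟩)

/-- Classes of paths lift to the covering space `ℍⁿ`, with a given initial point. -/
theorem exists_lifts (hΓ : IsClosedHyperbolic Γ) (a : PathClass A B) {x : Hyp n}
    (hx : proj Γ x = A) : ∃ y, Lifts a x y := by
  have cov := hΓ.isQuotientCoveringMap.isCoveringMap
  obtain ⟨d, rfl⟩ := Path.Homotopic.Quotient.mk_surjective a
  have h0 : (d : C(unitInterval, Mfd Γ)) 0 = proj Γ x := by rw [hx]; exact d.source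
  exact ⟨_, ⟨cov.liftPath d x h0, cov.liftPath_zero _ _ _, rfl⟩, d, rfl,
    fun t => (congrFun (cov.liftPath_lifts d x h0) t).symm⟩

theorem Lifts.target_unique (hΓ : IsClosedHyperbolic Γ) {a : PathClass A B} {x y y' : Hyp n}
    (h : Lifts a x y) (h' : Lifts a x y') : y = y' := by
  have cov := hΓ.isQuotientCoveringMap.isCoveringMap
  obtain ⟨c, d, hda, hd⟩ := h
  obtain ⟨c', d', rfl, hd'⟩ := h'
  have hom := Path.Homotopic.Quotient.exact hda
  have h0 : (d : C(unitInterval, Mfd Γ)) 0 = proj Γ x := (hd 0).trans (by rw [c.source])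
  have h0' : (d' : C(unitInterval, Mfd Γ)) 0 = proj Γ x := (hd' 0).trans (by rw [c'.source])
  have e : (c : C(unitInterval, Hyp n)) = cov.liftPath d x h0 :=
    (cov.eq_liftPath_iff' _).2 ⟨funext fun t => (hd t).symm, c.source⟩
  have e' : (c' : C(unitInterval, Hyp n)) = cov.liftPath d' x h0' :=
    (cov.eq_liftPath_iff' _).2 ⟨funext fun t => (hd' t).symm, c'.source⟩
  have h1 := cov.liftPath_apply_one_eq_of_homotopicRel hom x h0 h0'
  exact c.target.symm.trans ((congrArg (fun f : C(unitInterval, Hyp n) => f 1) e).trans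
    (h1.trans ((congrArg (fun f : C(unitInterval, Hyp n) => f 1) e').symm.trans c'.target)))

theorem IsClosedHyperbolic.eq_of_smul_eq (hΓ : IsClosedHyperbolic Γ) {g h : Isom n} (hg : g ∈ Γ)
    (hh : h ∈ Γ) {x : Hyp n} (e : g • x = h • x) : g = h := by
  have := hΓ.free (h⁻¹ * g) (Γ.mul_mem (Γ.inv_mem hh) hg) x (by rw [mul_smul, e, inv_smul_smul])
  exact (inv_mul_eq_one.1 this).symm

theorem continuous_flow_base (τ : TangentVector n) : Continuous fun t : ℝ => (τ.flow t).base := by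
  apply Continuous.subtype_mk
  have h1 := Real.continuous_cosh
  have h2 := Real.continuous_sinh
  fun_prop

theorem flow_zero_base (τ : TangentVector n) : (τ.flow 0).base = τ.base := by
  apply Subtype.ext; simp [TangentVector.flow]

/-- The geodesic with initial velocity `τ`, in the time interval `[0,1]`. -/
def geodesicPath (τ : TangentVector n) : Path τ.base (τ.flow 1).base where
  toFun t := (τ.flow t).base
  continuous_toFun := (continuous_flow_base τ).comp continuous_subtype_val
  source' := flow_zero_base τ
  target' := rfl

theorem IsGeodesicLift.lifts {c : Path A B} {τ : TangentVector n} (h : IsGeodesicLift c τ) :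
    Lifts (Path.Homotopic.Quotient.mk c) τ.base (τ.flow 1).base :=
  ⟨geodesicPath τ, c, rfl, h⟩

theorem IsGeodesicLift.map {c : Path A B} {τ : TangentVector n} (h : IsGeodesicLift c τ)
    {g : Isom n} (hg : g ∈ Γ) : IsGeodesicLift c (τ.map g) := by
  intro t
  rw [TangentVector.flow_map, h t]
  exact (proj_smul hg _).symm

/-- Two geodesic lifts of one path differ by a deck transformation, which can be read off at the
initial points. -/
theorem IsGeodesicLift.eq_map (hΓ : IsClosedHyperbolic Γ) {c : Path A B} {τ σ : TangentVector n}
    (hτ : IsGeodesicLift c τ) (hσ : IsGeodesicLift c σ) {g : Isom n} (hg : g ∈ Γ)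
    (hb : g • τ.base = σ.base) : σ = τ.map g := by
  have h1 := (hτ.map hg).lifts
  have h2 := hσ.lifts
  rw [← hb] at h2
  have h3 := Lifts.target_unique hΓ h1 h2
  calc σ = geo σ.base ((τ.map g).flow 1).base := eq_geo h3.symm
    _ = geo (τ.map g).base ((τ.map g).flow 1).base := by rw [← hb]; rfl
    _ = τ.map g := (eq_geo rfl).symm

end Lifting

/-! ### Theta graphs and their developments -/

section Development

variable {n : ℕ} {Γ : Subgroup (Isom n)}

/-- The deck transformations of the loops `γᵢ` at the lift `s` of the base point are the quotients
of consecutive terms of the sequence `a`. The relation `γ₀ γ₁ γ₂ = 1` is then automatic. -/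
structure IsHolonomy (S : Pants Γ) (s : Hyp n) (a : ZMod 3 → Γ) : Prop where
  base : proj Γ s = S.base
  loop : ∀ i, Lifts (S.loop (i + 1)) s (((a i : Isom n) * (a (i + 1) : Isom n)⁻¹) • s)

/-- Loops are multiplied in the order of travel, and `FundamentalGroup` multiplies in the opposite
order, whence the opposite group in the definition of `Pants`. -/
theorem Pants.loop_relation (S : Pants Γ) :
    ((S.loop 0).trans (S.loop 1)).trans (S.loop 2) = Path.Homotopic.Quotient.refl S.base := by
  have h : (PresentedGroup.of 0 * PresentedGroup.of 1 * PresentedGroup.of 2 : PantsGroup) = 1 :=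
    PresentedGroup.one_of_mem (Set.mem_singleton _)
  have h1 := congrArg (fun w => (S.rep w).unop) h
  simp only [_root_.map_mul, _root_.map_one, MulOpposite.unop_mul, MulOpposite.unop_one] at h1
  exact h1

theorem exists_isHolonomy (hΓ : IsClosedHyperbolic Γ) (S : Pants Γ) :
    ∃ s a, IsHolonomy S s a := by
  obtain ⟨s, hs⟩ := hΓ.isQuotientCoveringMap.surjective S.base
  have hg : ∀ i, ∃ g : Γ, Lifts (S.loop i) s ((g : Isom n) • s) := by
    intro i
    obtain ⟨y, hy⟩ := exists_lifts hΓ (S.loop i) hs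
    obtain ⟨g, hg, rfl⟩ := exists_smul_eq (hs.trans hy.target.symm)
    exact ⟨⟨g, hg⟩, hy⟩
  choose g hg using hg
  have hrel : g 0 * g 1 * g 2 = 1 := by
    have h := ((hg 0).trans ((hg 1).smul (g 0).2)).trans ((hg 2).smul (g 0 * g 1).2)
    rw [S.loop_relation] at h
    have h1 := Lifts.target_unique hΓ h (Lifts.refl hs)
    exact Subtype.ext (hΓ.free _ (g 0 * g 1 * g 2).2 s h1)
  let a : ZMod 3 → Γ := (![g 1 * g 2, g 2, 1] : Fin 3 → Γ)
  refine ⟨s, a, hs, fun i => ?_⟩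
  have key : ∀ i : ZMod 3, g (i + 1) = a i * (a (i + 1))⁻¹ := by
    have h12 : (1 + 1 : ZMod 3) = 2 := by decide
    have h21 : (2 + 1 : ZMod 3) = 0 := by decide
    intro i
    obtain rfl | rfl | rfl : i = 0 ∨ i = 1 ∨ i = 2 := by revert i; decide
    · rw [zero_add]
      change g 1 = g 1 * g 2 * (g 2)⁻¹
      group
    · rw [h12]
      change g 2 = g 2 * 1⁻¹
      group
    · rw [h21]
      change g 0 = 1 * (g 1 * g 2)⁻¹
      rw [one_mul, eq_inv_iff_mul_eq_one, ← mul_assoc, hrel]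
  have h := hg (i + 1)
  rw [key] at h
  exact h

/-- The cuffs of a good pants are the axes of the holonomies. -/
theorem Pants.CuffIsGood.exists_translation (hΓ : IsClosedHyperbolic Γ) {S : Pants Γ} {R ε : ℝ}
    {s : Hyp n} {i : ZMod 3} (h : S.CuffIsGood R ε i) {g : Isom n} (hg : g ∈ Γ)
    (hs : Lifts (S.loop i) s (g • s)) :
    ∃ ℓ, HasTranslationLength g ℓ ∧ 2 * R - 2 * ε < ℓ ∧ ℓ < 2 * R + 2 * ε := by
  obtain ⟨A, c, τ, h, hc, ⟨η, hη⟩, h1, h2, -⟩ := h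
  obtain ⟨y, hy⟩ := exists_lifts hΓ η hs.source
  obtain ⟨δ, hδ, rfl⟩ := exists_smul_eq (hc.lift.lifts.source.trans hy.target.symm)
  have e1 := (hy.symm.trans hs).trans (hy.smul hg)
  have e2 := hc.lift.lifts.smul hδ
  rw [hη] at e2
  have e3 := Lifts.target_unique hΓ e1 e2
  rw [hc.closes] at e3
  change g • δ • τ.base = δ • h • τ.base at e3
  rw [← mul_smul, ← mul_smul] at e3
  have e4 := hΓ.eq_of_smul_eq (Γ.mul_mem hg hδ) (Γ.mul_mem hδ hc.mem) e3
  refine ⟨τ.speed, ?_, h1, h2⟩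
  rw [← eq_mul_inv_iff_mul_eq] at e4
  rw [e4]
  exact (TangentVector.hasTranslationLength hc.speed_pos hc.closes).conj δ

/-- The edges of `G` lift to the geodesics from `p` to the points `a i • q`. -/
structure IsDevelopment (G : ThetaGraph Γ) (a : ZMod 3 → Γ) (p q : Hyp n) : Prop where
  vertexP : proj Γ p = G.P
  vertexQ : proj Γ q = G.Q
  lift : ∀ i, IsGeodesicLift (G.edge i).path (geo p ((a i : Isom n) • q))
  length_edge : ∀ i, (G.edge i).length = hdist p ((a i : Isom n) • q)

variable {G : ThetaGraph Γ} {S : Pants Γ} {s p q : Hyp n} {a : ZMod 3 → Γ}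

theorem IsDevelopment.length_eq (h : IsDevelopment G a p q) :
    G.length = thetaLength (fun i => (a i : Isom n)) p q :=
  Finset.sum_congr rfl fun i _ => h.length_edge i

/-- A theta graph is determined by its development. -/
theorem IsDevelopment.eq {G' : ThetaGraph Γ} (h : IsDevelopment G a p q)
    (h' : IsDevelopment G' a p q) : G' = G := by
  obtain ⟨P, Q, e⟩ := G
  obtain ⟨P', Q', e'⟩ := G'
  obtain ⟨hP, hQ, hl, hn⟩ := h
  obtain ⟨hP', hQ', hl', hn'⟩ := h'
  dsimp only at hP hQ hl hn hP' hQ' hl' hn'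
  subst hP hQ hP' hQ'
  congr 1
  funext i
  have h1 := hl i
  have h2 := hl' i
  have h3 := hn i
  have h4 := hn' i
  cases hei : e i
  cases hei' : e' i
  rw [hei] at h1 h3
  rw [hei'] at h2 h4
  congr 1
  · exact Path.ext (funext fun t => (h2 t).trans (h1 t).symm)
  · exact h4.trans h3.symm

/-- Every theta graph which generates `S` develops to a pair of points. -/
theorem IsHolonomy.exists_development (hΓ : IsClosedHyperbolic Γ) (ha : IsHolonomy S s a)
    (hG : G.Generates S) : ∃ p q, IsDevelopment G a p q := by
  obtain ⟨α, hα⟩ := hG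
  obtain ⟨p, hp⟩ := exists_lifts hΓ α ha.base
  have hτ : ∀ i, ∃ x, IsGeodesicLift (G.edge i).path (geo p x) ∧
      (G.edge i).length = hdist p x := by
    intro i
    obtain ⟨τ, hτ, hlen⟩ := (G.edge i).isGeodesic
    obtain ⟨g, hg, hgp⟩ := exists_smul_eq (hτ.lifts.source.trans hp.target.symm)
    have h1 := eq_geo (τ := τ.map g) rfl
    have h2 : (τ.map g).base = p := hgp
    rw [h2] at h1
    refine ⟨((τ.map g).flow 1).base, ?_, ?_⟩
    · rw [← h1]; exact hτ.map hg
    · rw [← speed_geo, ← h1, TangentVector.speed_map, hlen]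
  choose x hx hlen using hτ
  have hlift : ∀ i, Lifts (G.edgeClass i) p (x i) := by
    intro i
    have := (hx i).lifts
    rwa [geo_flow_one] at this
  have hrel : ∀ i, x i = ((a i : Isom n) * (a (i + 1) : Isom n)⁻¹) • x (i + 1) := by
    intro i
    obtain ⟨h, hh, hhx⟩ := exists_smul_eq ((hlift (i + 1)).target.trans (hlift i).target.symm)
    have hgΓ : (a i : Isom n) * (a (i + 1) : Isom n)⁻¹ ∈ Γ :=
      Γ.mul_mem (a i).2 (Γ.inv_mem (a (i + 1)).2)
    have e1 := (hlift (i + 1)).smul hh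
    rw [hhx] at e1
    have e2 := (hlift i).trans e1.symm
    rw [hα i] at e2
    have e3 := (hp.symm.trans (ha.loop i)).trans (hp.smul hgΓ)
    rw [← hhx, hΓ.eq_of_smul_eq hh hgΓ (Lifts.target_unique hΓ e2 e3)]
  have hq : ∀ i, x i = (a i : Isom n) • (a 0 : Isom n)⁻¹ • x 0 := by
    have step : ∀ i, (a i : Isom n)⁻¹ • x i = (a (i + 1) : Isom n)⁻¹ • x (i + 1) := by
      intro i
      conv_lhs => rw [hrel i, mul_smul, inv_smul_smul]
    have h01 := step 0
    have h12 := step 1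
    rw [zero_add] at h01
    rw [show (1 + 1 : ZMod 3) = 2 by decide] at h12
    intro i
    rw [← inv_smul_eq_iff]
    obtain rfl | rfl | rfl : i = 0 ∨ i = 1 ∨ i = 2 := by revert i; decide
    · rfl
    · exact h01.symm
    · exact h12.symm.trans h01.symm
  refine ⟨p, (a 0 : Isom n)⁻¹ • x 0, hp.target, ?_, fun i => ?_, fun i => ?_⟩
  · rw [proj_smul (Γ.inv_mem (a 0).2)]; exact (hlift 0).target
  · rw [← hq]; exact hx i
  · rw [← hq]; exact hlen i

/-- Every pair of points is the development of a theta graph which generates `S`. -/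
theorem IsHolonomy.exists_generates (ha : IsHolonomy S s a)
    (p q : Hyp n) : ∃ G : ThetaGraph Γ, G.Generates S ∧ IsDevelopment G a p q := by
  let e : ∀ i : ZMod 3, Path (proj Γ p) (proj Γ q) := fun i =>
    ((geodesicPath (geo p ((a i : Isom n) • q))).map continuous_proj).cast rfl
      (by rw [geo_flow_one, proj_smul (a i).2])
  let G : ThetaGraph Γ :=
    ⟨proj Γ p, proj Γ q, fun i => ⟨e i, hdist p ((a i : Isom n) • q), geo p ((a i : Isom n) • q),
      fun t => rfl, speed_geo _ _⟩⟩
  have hlift : ∀ i, Lifts (G.edgeClass i) p ((a i : Isom n) • q) := by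
    intro i
    have : IsGeodesicLift (G.edge i).path (geo p ((a i : Isom n) • q)) := fun t => rfl
    have := this.lifts
    rwa [geo_flow_one] at this
  refine ⟨G, ?_, rfl, rfl, fun i t => rfl, fun i => rfl⟩
  obtain ⟨α, hα⟩ : ∃ α : PathClass S.base (proj Γ p), Lifts α s p :=
    ⟨Path.Homotopic.Quotient.mk (((PathConnectedSpace.somePath s p).map continuous_proj).cast
      ha.base.symm rfl), _, _, rfl, fun t => rfl⟩
  refine ⟨α, fun i => ?_⟩
  have hgΓ : (a i : Isom n) * (a (i + 1) : Isom n)⁻¹ ∈ Γ :=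
    Γ.mul_mem (a i).2 (Γ.inv_mem (a (i + 1)).2)
  refine Lifts.eq (x := p) (y := ((a i : Isom n) * (a (i + 1) : Isom n)⁻¹) • p) ?_
    ((hα.symm.trans (ha.loop i)).trans (hα.smul hgΓ))
  refine (hlift i).trans ?_
  have := ((hlift (i + 1)).smul hgΓ).symm
  rwa [mul_smul, inv_smul_smul] at this

end Development

/-! ### Directions at the vertices -/

section Directions

variable {n : ℕ} {Γ : Subgroup (Isom n)} {G : ThetaGraph Γ} {p q : Hyp n} {a : ZMod 3 → Γ}

/-- Unit vectors with sum zero give tripods, whichever lift of the vertex is used. -/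
theorem angle_and_isTripod {x : ZMod 3 → Hyp n} (hne : ∀ i, p ≠ x i)
    (hsum : ∑ i, dir p (x i) = 0) {τ : ZMod 3 → TangentVector n} {g : Isom n}
    (hτ : ∀ i, τ i = (geo p (x i)).map g) :
    (∀ i j, i ≠ j → (τ i).angle (τ j) = 2 * Real.pi / 3) ∧
      ∀ f : ZMod 3 → ZMod 3, f.Injective → IsTripod fun i => (τ (f i)).unit := by
  have hang : ∀ i j, i ≠ j → (τ i).angle (τ j) = 2 * Real.pi / 3 := fun i j hij => by
    rw [hτ, hτ, angle_map, angle_geo hne hsum hij]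
  refine ⟨hang, fun f hf => isTripod_unit (τ := fun i => τ (f i)) (fun i j => ?_) (fun i => ?_)
    fun i j hij => hang _ _ (hf.ne hij)⟩
  · rw [hτ, hτ]
    rfl
  · rw [hτ, TangentVector.speed_map, speed_geo]
    exact hdist_pos (hne _)

theorem IsDevelopment.directionsAtP (hΓ : IsClosedHyperbolic Γ) (h : IsDevelopment G a p q)
    {τ : ZMod 3 → TangentVector n} (hτ : G.DirectionsAtP τ) :
    ∃ g : Isom n, ∀ i, τ i = (geo p ((a i : Isom n) • q)).map g := by
  obtain ⟨g, hg, hgp⟩ := exists_smul_eq (h.vertexP.trans (hτ.2 0).lifts.source.symm)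
  exact ⟨g, fun i => (h.lift i).eq_map hΓ (hτ.2 i) hg (hgp.trans (hτ.1 0 i))⟩

theorem IsDevelopment.directionsAtQ (hΓ : IsClosedHyperbolic Γ) (h : IsDevelopment G a p q)
    {σ : ZMod 3 → TangentVector n} (hσ : G.DirectionsAtQ σ) :
    ∃ g : Isom n, ∀ i, σ i = (geo q ((a i : Isom n)⁻¹ • p)).map g := by
  have key : ∀ i, ∃ g ∈ Γ, σ i = (geo q ((a i : Isom n)⁻¹ • p)).map g := by
    intro i
    obtain ⟨τ, hτ, hστ⟩ := hσ.2 i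
    obtain ⟨g, hg, hgp⟩ := exists_smul_eq (h.vertexP.trans hτ.lifts.source.symm)
    refine ⟨g * a i, Γ.mul_mem hg (a i).2, ?_⟩
    rw [hστ, (h.lift i).eq_map hΓ hτ hg hgp, TangentVector.flow_map, TangentVector.reverse_map,
      reverse_geo_flow, TangentVector.map_mul, map_geo (a i : Isom n), smul_inv_smul]
  choose g hg hσg using key
  refine ⟨g 0, fun i => ?_⟩
  have h0 : g i • q = g 0 • q := by
    have := hσ.1 i 0
    rw [hσg, hσg] at this
    exact this
  rw [hσg, hΓ.eq_of_smul_eq (hg i) (hg 0) h0]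

theorem IsDevelopment.isMinimal {S : Pants Γ} {s : Hyp n} (ha : IsHolonomy S s a)
    (h : IsDevelopment G a p q) (hG : G.IsSteinerGraph S) :
    IsMinimal (fun i => (a i : Isom n)) p q := by
  intro p' q'
  obtain ⟨G', hG', h'⟩ := ha.exists_generates p' q'
  rw [← h.length_eq, ← h'.length_eq]
  exact hG.2 G' hG'

end Directions

end SteinerPants

end

open SteinerPants in
theorem proposition2p6 :
    ∃ R₀ : ℝ, 0 < R₀ ∧ ∀ R : ℝ, R₀ < R → ∀ ε : ℝ, 0 ≤ ε → ε < 1 →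
      ∀ (n : ℕ) (Γ : Subgroup (Isom n)), IsClosedHyperbolic Γ →
      ∀ S : Pants Γ, S.IsCuffGood R ε →
        ∃ G : ThetaGraph Γ, G.IsSteinerGraph S ∧
          (∀ G' : ThetaGraph Γ, G'.IsSteinerGraph S → G' = G) ∧
          ¬ G.IsDegenerate ∧
          (∀ τ, G.DirectionsAtP τ → ∀ i j, i ≠ j → (τ i).angle (τ j) = 2 * Real.pi / 3) ∧
          (∀ σ, G.DirectionsAtQ σ → ∀ i j, i ≠ j → (σ i).angle (σ j) = 2 * Real.pi / 3) ∧
          (∀ τ, G.DirectionsAtP τ → IsTripod (fun i => (τ i).unit)) ∧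
          (∀ σ, G.DirectionsAtQ σ → IsTripod (fun i => (σ (-i)).unit)) := by
  -- `4 < R` is equivalent to `2 * R + 2 < 4 * R - 6`.
  refine ⟨4, by norm_num, fun R hR ε _ hε n Γ hΓ S hS => ?_⟩
  obtain ⟨s, a, ha⟩ := exists_isHolonomy hΓ S
  have hcuff : ∀ i, ∃ ℓ, HasTranslationLength ((a i : Isom n) * (a (i + 1) : Isom n)⁻¹) ℓ ∧
      2 * R - 2 * ε < ℓ ∧ ℓ < 2 * R + 2 * ε := fun i =>
    (hS (i + 1)).exists_translation hΓ (Γ.mul_mem (a i).2 (Γ.inv_mem (a (i + 1)).2)) (ha.loop i)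
  choose ℓ htr hlow hup using hcuff
  obtain ⟨p, q, hmin⟩ := hΓ.exists_isMinimal a
  have hne := hmin.ne_smul hR htr (fun i => by linarith [hlow i]) fun i => by linarith [hup i]
  have hne' : ∀ i, q ≠ (a i : Isom n)⁻¹ • p := fun i hi => hne i (by rw [hi, smul_inv_smul])
  have hsum := hmin.sum_dir hne
  have hsum' := hmin.swap.sum_dir hne'
  obtain ⟨G, hG, hdev⟩ := ha.exists_generates p q
  refine ⟨G, ⟨hG, fun G' hG' => ?_⟩, fun G' hG' => ?_, ?_, fun τ hτ => ?_, fun σ hσ => ?_,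
    fun τ hτ => ?_, fun σ hσ => ?_⟩
  · obtain ⟨p', q', hdev'⟩ := ha.exists_development hΓ hG'
    rw [hdev.length_eq, hdev'.length_eq]
    exact hmin p' q'
  · obtain ⟨p', q', hdev'⟩ := ha.exists_development hΓ hG'.1
    obtain ⟨rfl, rfl⟩ := hmin.unique (hdev'.isMinimal ha hG') hne
    exact hdev.eq hdev'
  · rintro ⟨i, hi⟩
    rw [hdev.length_edge, hdist_eq_zero_iff] at hi
    exact hne i hi
  · obtain ⟨g, hg⟩ := hdev.directionsAtP hΓ hτ
    exact (angle_and_isTripod hne hsum hg).1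
  · obtain ⟨g, hg⟩ := hdev.directionsAtQ hΓ hσ
    exact (angle_and_isTripod hne' hsum' hg).1
  · obtain ⟨g, hg⟩ := hdev.directionsAtP hΓ hτ
    exact (angle_and_isTripod hne hsum hg).2 id Function.injective_id
  · obtain ⟨g, hg⟩ := hdev.directionsAtQ hΓ hσ
    exact (angle_and_isTripod hne' hsum' hg).2 Neg.neg neg_injective
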